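/- Let $K$ be a field. For $n\ge 2$ let $A_n$ be the Nakayama $K$-algebra with Kupisch series $[3,\dots,3,2,1]$ ($n$ entries), that is, $A_n=KQ/J_Q^3$, where $Q$ is the linear quiver $0\to 1\to\cdots\to n-1$ and $J_Q$ is the ideal of its path algebra generated by the arrows; paths are written from left to right, $e_i$ is the trivial path at the vertex $i$, and $e_iA_n$ has as basis the paths of length at most $2$ starting at $i$. Modules are finitely generated right modules. Write $A=A_n$ for the algebra in question, $J$ for its Jacobson radical, and $S_i=e_iA/e_iJ$. For a module $M$ with minimal injective resolution $0\to M\to I_0\to I_1\to\cdots$ let $\Omega^{-s}(M)$ be the kernel of $I_s\to I_{s+1}$ (so $\Omega^{0}(M)\cong M$, and $\Omega^{-s}(M)$ is the image of $I_{s-1}\to I_s$ for $s\ge 1$), and let the dominant dimension $\operatorname{domdim}(M)$ be the supremum of all $s\ge 0$ such that $I_0,\dots,I_{s-1}$ are projective. Let $\operatorname{domdim}(A)$ be the dominant dimension of the regular module $A$, and let $\operatorname{gldim}(A)$ be the supremum of the projective dimensions of the $A$-modules. Then the following holds for every $m\ge 1$. 1. $\operatorname{domdim}(A_{3m})=\operatorname{gldim}(A_{3m})=2m-1$.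 2. $\operatorname{domdim}(A_{3m+1})=2m-1$ and $\operatorname{gldim}(A_{3m+1})=2m$, and, with $A=A_{3m+1}$, $\Omega^{-(2m-1)}(A)\cong e_1A/e_1J^2\oplus S_1$. 3. $\operatorname{domdim}(A_{3m+2})=2m$ and $\operatorname{gldim}(A_{3m+2})=2m+1$, and, with $A=A_{3m+2}$, $\Omega^{-2m}(A)\cong e_0A/e_0J^2\oplus S_1$. -/

import Mathlib

open CategoryTheory

universe u

noncomputable section

/-! ### Nakayama algebras with a linear quiver -/

/-- A Kupisch series of length `n` belonging to a connected Nakayama algebra whose quiver is the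
directed line `0 → 1 → ⋯ → n - 1`: `c (n - 1) = 1`, and `2 ≤ c i ≤ c (i + 1) + 1` for `i < n - 1`. -/
structure LinearKupischSeries (n : ℕ) where
  c : Fin n → ℕ
  last : ∀ i : Fin n, (i : ℕ) + 1 = n → c i = 1
  two_le : ∀ i : Fin n, (i : ℕ) + 1 < n → 2 ≤ c i
  le_succ : ∀ i j : Fin n, (j : ℕ) = (i : ℕ) + 1 → c i ≤ c j + 1

namespace LinearKupischSeries

variable {n : ℕ} (c : LinearKupischSeries n)

/-- The (unique) path of the linear quiver from `i` to `j` exists and is nonzero in the Nakayama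
algebra: it exists iff `i ≤ j`, and the paths starting in `i` that are not killed by the relations
are those of length less than `c i`. -/
def IsPath (i j : Fin n) : Prop := i ≤ j ∧ (j : ℕ) < (i : ℕ) + c.c i

instance (i j : Fin n) : Decidable (c.IsPath i j) := inferInstanceAs (Decidable (_ ∧ _))

theorem one_le (i : Fin n) : 1 ≤ c.c i := by
  rcases Nat.lt_or_ge ((i : ℕ) + 1) n with h | h
  · exact le_trans (by norm_num) (c.two_le i h)
  · exact (c.last i (by omega)).ge

theorem isPath_self (i : Fin n) : c.IsPath i i :=
  ⟨le_rfl, by have := c.one_le i; omega⟩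

theorem add_le_add {i j : Fin n} (h : i ≤ j) : (i : ℕ) + c.c i ≤ (j : ℕ) + c.c j := by
  obtain ⟨d, hd⟩ := Nat.exists_eq_add_of_le (Fin.le_def.1 h)
  induction d generalizing j with
  | zero =>
    have : j = i := Fin.ext (by omega)
    rw [this]
  | succ d ih =>
    have hlt : (i : ℕ) + d < n := by omega
    have h1 := ih (j := ⟨(i : ℕ) + d, hlt⟩) (Fin.le_def.2 (by simp)) rfl
    have h2 := c.le_succ ⟨(i : ℕ) + d, hlt⟩ j (by simp; omega)
    simp only at h1
    omega

theorem IsPath.left {c : LinearKupischSeries n} {i j k : Fin n} (h : c.IsPath i k)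
    (hij : i ≤ j) (hjk : j ≤ k) : c.IsPath i j :=
  ⟨hij, lt_of_le_of_lt (Fin.le_def.1 hjk) h.2⟩

theorem IsPath.right {c : LinearKupischSeries n} {i j k : Fin n} (h : c.IsPath i k)
    (hij : i ≤ j) (hjk : j ≤ k) : c.IsPath j k :=
  ⟨hjk, lt_of_lt_of_le h.2 (c.add_le_add hij)⟩

end LinearKupischSeries

/-- The space with basis the nonzero paths; the path from `i` to `j` is the matrix unit `(i, j)`. -/
def pathSpace (K : Type u) [Field K] {n : ℕ} (c : LinearKupischSeries n) :
    Submodule K (Matrix (Fin n) (Fin n) K) where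
  carrier := {M | ∀ i j, ¬ c.IsPath i j → M i j = 0}
  add_mem' {M N} hM hN i j h := by simp [hM i j h, hN i j h]
  zero_mem' i j _ := rfl
  smul_mem' a M hM i j h := by simp [hM i j h]

/-- The quiver Nakayama algebra over `K` with Kupisch series `c`: the path algebra of
`0 → 1 → ⋯ → n - 1` modulo, for each `i`, the path of length `c i` starting in `i` (where it
exists). It has the nonzero paths as a basis. -/
def NakayamaAlgebra (K : Type u) [Field K] {n : ℕ} (c : LinearKupischSeries n) : Type u :=
  pathSpace K c

namespace NakayamaAlgebra

variable {K : Type u} [Field K] {n : ℕ} {c : LinearKupischSeries n}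

instance : AddCommGroup (NakayamaAlgebra K c) := inferInstanceAs (AddCommGroup (pathSpace K c))

instance : Module K (NakayamaAlgebra K c) := inferInstanceAs (Module K (pathSpace K c))

/-- The coefficient of `x` at the path from `i` to `j`. -/
def coeff (x : NakayamaAlgebra K c) : Matrix (Fin n) (Fin n) K := x.1

theorem coeff_eq_zero (x : NakayamaAlgebra K c) {i j : Fin n} (h : ¬ c.IsPath i j) :
    x.coeff i j = 0 := x.2 i j h

@[ext]
theorem ext {x y : NakayamaAlgebra K c} (h : ∀ i j, c.IsPath i j → x.coeff i j = y.coeff i j) :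
    x = y := by
  refine Subtype.ext (Matrix.ext fun i j => ?_)
  by_cases hp : c.IsPath i j
  · exact h i j hp
  · exact (x.2 i j hp).trans (y.2 i j hp).symm

@[simp] theorem coeff_add (x y : NakayamaAlgebra K c) : (x + y).coeff = x.coeff + y.coeff := rfl

@[simp] theorem coeff_zero : (0 : NakayamaAlgebra K c).coeff = 0 := rfl

@[simp] theorem coeff_smul (a : K) (x : NakayamaAlgebra K c) : (a • x).coeff = a • x.coeff := rfl

/-- The sum of the trivial paths. -/
instance : One (NakayamaAlgebra K c) :=
  ⟨⟨1, fun i j h => Matrix.one_apply_ne (fun hij => h (hij ▸ c.isPath_self i))⟩⟩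

/-- Concatenation of paths, written from left to right: `(i, j) * (j, k) = (i, k)` if the path from
`i` to `k` is nonzero, and all other products of paths are `0`. -/
instance : Mul (NakayamaAlgebra K c) :=
  ⟨fun x y => ⟨Matrix.of fun i k => if c.IsPath i k then (x.coeff * y.coeff) i k else 0,
    fun _ _ h => by simp [h]⟩⟩

@[simp] theorem coeff_one : (1 : NakayamaAlgebra K c).coeff = 1 := rfl

theorem coeff_mul (x y : NakayamaAlgebra K c) {i k : Fin n} (h : c.IsPath i k) :
    (x * y).coeff i k = ∑ j, x.coeff i j * y.coeff j k :=
  (if_pos h : (if c.IsPath i k then (x.coeff * y.coeff) i k else 0) = _)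

theorem mul_coeff_eq_zero (x y : NakayamaAlgebra K c) {i k : Fin n} (h : ¬ i ≤ k) :
    ∑ j, x.coeff i j * y.coeff j k = 0 := by
  refine Finset.sum_eq_zero fun j _ => ?_
  by_cases h1 : c.IsPath i j
  · have h2 : ¬ c.IsPath j k := fun h2 => h (h1.1.trans h2.1)
    rw [y.coeff_eq_zero h2, mul_zero]
  · rw [x.coeff_eq_zero h1, zero_mul]

theorem mul_assoc' (x y z : NakayamaAlgebra K c) : x * y * z = x * (y * z) := by
  ext i l h
  have hl : ∀ k, (x * y).coeff i k * z.coeff k l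
      = (∑ j, x.coeff i j * y.coeff j k) * z.coeff k l := by
    intro k
    by_cases hz : c.IsPath k l
    · by_cases hik : i ≤ k
      · rw [coeff_mul x y (h.left hik hz.1)]
      · rw [mul_coeff_eq_zero x y hik, coeff_eq_zero _ (fun h' => hik h'.1)]
    · rw [z.coeff_eq_zero hz, mul_zero, mul_zero]
  have hr : ∀ j, x.coeff i j * (y * z).coeff j l
      = x.coeff i j * (∑ k, y.coeff j k * z.coeff k l) := by
    intro j
    by_cases hx : c.IsPath i j
    · by_cases hjl : j ≤ l
      · rw [coeff_mul y z (h.right hx.1 hjl)]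
      · rw [mul_coeff_eq_zero y z hjl, coeff_eq_zero _ (fun h' => hjl h'.1)]
    · rw [x.coeff_eq_zero hx, zero_mul, zero_mul]
  rw [coeff_mul _ _ h, coeff_mul _ _ h, Finset.sum_congr rfl fun k _ => hl k,
    Finset.sum_congr rfl fun j _ => hr j]
  simp_rw [Finset.sum_mul, Finset.mul_sum]
  rw [Finset.sum_comm]
  simp_rw [mul_assoc]

instance : Ring (NakayamaAlgebra K c) :=
  { (inferInstance : AddCommGroup (NakayamaAlgebra K c)) with
    mul := (· * ·)
    one := 1
    mul_assoc := mul_assoc'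
    one_mul := fun x => by ext i j h; simp [coeff_mul _ _ h, Matrix.one_apply]
    mul_one := fun x => by ext i j h; simp [coeff_mul _ _ h, Matrix.one_apply]
    left_distrib := fun x y z => by
      ext i j h; simp [coeff_mul _ _ h, mul_add, Finset.sum_add_distrib]
    right_distrib := fun x y z => by
      ext i j h; simp [coeff_mul _ _ h, add_mul, Finset.sum_add_distrib]
    zero_mul := fun x => by ext i j h; simp [coeff_mul _ _ h]
    mul_zero := fun x => by ext i j h; simp [coeff_mul _ _ h] }

instance : Algebra K (NakayamaAlgebra K c) :=
  Algebra.ofModule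
    (fun a x y => by ext i j h; simp [coeff_mul _ _ h, Finset.mul_sum, mul_assoc])
    (fun a x y => by ext i j h; simp [coeff_mul _ _ h, Finset.mul_sum, mul_left_comm])

/-- The primitive idempotent `e_i`, that is, the trivial path at the vertex `i`. -/
def e (i : Fin n) : NakayamaAlgebra K c :=
  ⟨Matrix.single i i 1, fun j k h => Matrix.single_apply_of_ne _ _ _ _ _ (by
    rintro ⟨rfl, rfl⟩; exact h (c.isPath_self _))⟩

end NakayamaAlgebra

/-- The Kupisch series `[3, …, 3, 2, 1]` with `n` entries. -/
def kupischA (n : ℕ) : LinearKupischSeries n where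
  c i := if (i : ℕ) + 3 ≤ n then 3 else n - i
  last i h := by split_ifs <;> omega
  two_le i h := by split_ifs <;> omega
  le_succ i j h := by split_ifs <;> omega

/-- The algebra `A_n`. -/
abbrev AlgA (K : Type u) [Field K] (n : ℕ) : Type u := NakayamaAlgebra K (kupischA n)

/-! ### Right modules `eA / eJ^k`

Right modules over `A` are modules over `Aᵐᵒᵖ`. -/

section RightModules

variable {A : Type u} [Ring A]

/-- The right ideal `xA`. -/
def rightIdeal (x : A) : Submodule Aᵐᵒᵖ A := Submodule.span Aᵐᵒᵖ {x}

/-- The right ideal `xJ^k`, where `J` is the Jacobson radical of `A`. -/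
def rightIdealRadPow (x : A) (k : ℕ) : Submodule Aᵐᵒᵖ A :=
  Submodule.span Aᵐᵒᵖ ((fun y => x * y) '' ((Ring.jacobson A ^ k : Ideal A) : Set A))

/-- The right module `xA / xJ^k`. -/
abbrev RadQuotient (x : A) (k : ℕ) : Type u :=
  ↥(rightIdeal x) ⧸ (rightIdealRadPow x k).submoduleOf (rightIdeal x)

end RightModules

/-! ### Minimal injective resolutions, dominant dimension, global dimension -/

/-- A submodule is essential if it meets every nonzero submodule nontrivially. -/
def IsEssentialSubmodule {R : Type*} {M : Type*} [Ring R] [AddCommGroup M] [Module R M]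
    (N : Submodule R M) : Prop :=
  ∀ L : Submodule R M, N ⊓ L = ⊥ → L = ⊥

section Resolutions

variable {R : Type u} [Ring R] {M : ModuleCat.{u} R}

/-- The `n`-th cosyzygy `Ω^{-n}(M)` with respect to an injective resolution
`0 → M → I_0 → I_1 → ⋯`: the kernel of `I_n → I_{n+1}`, which by exactness is `M` for `n = 0` and
the image of `I_{n-1} → I_n` for `n ≥ 1`. -/
def cosyzygy (I : InjectiveResolution M) (n : ℕ) : Submodule R (I.cocomplex.X n) :=
  LinearMap.ker (I.cocomplex.d n (n + 1)).hom

/-- An injective resolution is minimal if each `I_n` is an injective hull of `Ω^{-n}(M)`. -/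
def IsMinimalResolution (I : InjectiveResolution M) : Prop :=
  ∀ n, IsEssentialSubmodule (cosyzygy I n)

/-- The dominant dimension of a module: the supremum of the numbers `n` for which
`I_0, …, I_{n-1}` are projective, where `I` is a (the) minimal injective resolution. -/
def moduleDomdim (M : ModuleCat.{u} R) : ℕ∞ :=
  ⨆ (I : InjectiveResolution M) (_ : IsMinimalResolution I) (n : ℕ)
    (_ : ∀ i < n, Projective (I.cocomplex.X i)), (n : ℕ∞)

/-- `Ω^{-n}(M) ≅ N`: the module `M` has a minimal injective resolution, and the `n`-th cosyzygy of
each such resolution is isomorphic to `N`. -/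
def CosyzygyIso (M : ModuleCat.{u} R) (n : ℕ) (N : Type u) [AddCommGroup N] [Module R N] : Prop :=
  (∃ I : InjectiveResolution M, IsMinimalResolution I) ∧
    ∀ I : InjectiveResolution M, IsMinimalResolution I → Nonempty (cosyzygy I n ≃ₗ[R] N)

end Resolutions

/-- The regular right module of `A`. -/
abbrev regularModule (A : Type u) [Ring A] : ModuleCat.{u} Aᵐᵒᵖ := ModuleCat.of Aᵐᵒᵖ A

/-- The dominant dimension of an algebra. -/
def domdim (A : Type u) [Ring A] : ℕ∞ := moduleDomdim (regularModule A)

/-- The global dimension of a finite dimensional algebra: the supremum of the projective dimensions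
of its finitely generated right modules. -/
def gldim (A : Type u) [Ring A] : WithBot ℕ∞ :=
  ⨆ (M : ModuleCat.{u} Aᵐᵒᵖ) (_ : Module.Finite Aᵐᵒᵖ M), projectiveDimension M

end

/-! The proof reduces homological algebra over $A_n$ to arithmetic with intervals. An interval
$[a,c)$ of at most three vertices carries a uniserial module with top $S_a$ and socle $S_{c-1}$
(zero if $a=c$). It is projective if it reaches as far right as possible, $c=\min(a+3,n)$, and
injective if it reaches as far left as possible, $a=\max(c-3,0)$. Cutting an interval in two gives a
short exact sequence (`RowModule.exact_trunc`), so $\Omega^{-1}[a,c)=[c-3,a)$ and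
$\Omega[a,c)=[c,a+3)$, cut off at the ends $0$ and $n$. Consequently $\Omega^{-2}$ sends $S_{c-1}$
to $S_{c-4}$ and $\Omega^2$ sends $S_c$ to $S_{c+3}$, a simple module without a vertex being read as
zero.

Dominant dimension: $e_iA$ is injective for $i\le n-3$. Of the remaining two summands of $A$,
$e_{n-1}A$ is the simple $S_{n-1}$ and $e_{n-2}A$ has first cosyzygy $S_{n-3}$, so both walk down
the quiver, three vertices in two steps. The hull $[c-3,c)$ is projective while $c\ge 3$; the
dominant dimension is the first degree in which one of the walks has a nonzero term with $c\le 2$,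
and the residue of $n$ modulo $3$ decides which. The two terms in that degree give the stated
cosyzygies.

Global dimension: finitely generated modules have finite length, so only simple modules matter, and
each of these is an interval. The walk from $S_0$ to the right end is the longest and determines the
value.

The carrying lemmas are `RowModule.injective_of_lo`, `RowModule.projective_of_hi` and
`RowModule.not_projective` for single modules, `HullSequence.nonempty_cosyzygy_equiv` for
independence of the chosen minimal resolution, `gldim_eq` for the reduction to simple modules, and
`RowModule.radQuotientEquiv`, which recognises $e_iA/e_iJ^k$ as an interval. Families of intervals
are treated row by row, so that the regular module is resolved in one go. -/

noncomputable section

/-! ### Minimal injective resolutions: uniqueness, and construction by splicing -/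

section Resolutions

variable {R : Type u} [Ring R]

/-- An injective hull of a module is unique up to an isomorphism extending a given isomorphism of
the modules. -/
theorem exists_hull_equiv {E E' : Type u} [AddCommGroup E] [Module R E] [AddCommGroup E']
    [Module R E'] [Module.Injective R E] [Module.Injective R E'] {N : Submodule R E}
    {N' : Submodule R E'} (hN : IsEssentialSubmodule N) (hN' : IsEssentialSubmodule N')
    (φ : N ≃ₗ[R] N') : ∃ Φ : E ≃ₗ[R] E', ∀ x : N, Φ x = φ x := by
  obtain ⟨Φ, hΦ⟩ := Module.Injective.out N.subtype N.injective_subtype (N'.subtype ∘ₗ φ.toLinearMap)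
  have hker : LinearMap.ker Φ = ⊥ := by
    refine hN _ (eq_bot_iff.2 fun x hx => ?_)
    obtain ⟨hxN, h2⟩ := Submodule.mem_inf.1 hx
    rw [LinearMap.mem_ker] at h2
    have h1 := hΦ ⟨x, hxN⟩
    have h3 : φ ⟨x, hxN⟩ = 0 := by
      apply Subtype.ext
      simpa [h2] using h1.symm
    simpa using h3
  -- `ρ` is a left inverse of `Φ`. It is injective as well, since its kernel misses the essential
  -- submodule `N'`; so `Φ (ρ y) = y`, which is the surjectivity of `Φ`.
  obtain ⟨ρ, hρ⟩ := Module.Injective.out Φ (LinearMap.ker_eq_bot.1 hker) LinearMap.id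
  have hkerρ : LinearMap.ker ρ = ⊥ := by
    refine hN' _ (eq_bot_iff.2 fun x hx => ?_)
    obtain ⟨hxN, h2⟩ := Submodule.mem_inf.1 hx
    rw [LinearMap.mem_ker] at h2
    have h1 := hΦ (φ.symm ⟨x, hxN⟩)
    simp only [Submodule.subtype_apply, LinearMap.comp_apply, LinearEquiv.coe_coe,
      LinearEquiv.apply_symm_apply] at h1
    have h3 := hρ (φ.symm ⟨x, hxN⟩ : E)
    rw [h1, h2, LinearMap.id_apply] at h3
    rw [Submodule.mem_bot, ← h1, ← h3, map_zero]
  refine ⟨LinearEquiv.ofBijective Φ ⟨LinearMap.ker_eq_bot.1 hker, fun y => ⟨ρ y, ?_⟩⟩, fun x => hΦ x⟩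
  exact LinearMap.ker_eq_bot.1 hkerρ (hρ (ρ y))

/-- A sequence of short exact sequences `0 → C n → E n → C (n + 1) → 0` in which each `E n` is an
injective hull of `C n`. -/
structure HullSequence (R : Type u) [Ring R] where
  C : ℕ → ModuleCat.{u} R
  E : ℕ → ModuleCat.{u} R
  ι : ∀ n, C n →ₗ[R] E n
  π : ∀ n, E n →ₗ[R] C (n + 1)
  ι_injective : ∀ n, Function.Injective (ι n)
  exact : ∀ n, Function.Exact (ι n) (π n)
  π_surjective : ∀ n, Function.Surjective (π n)
  injective : ∀ n, Module.Injective R (E n)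
  essential : ∀ n, IsEssentialSubmodule (LinearMap.range (ι n))

theorem InjectiveResolution.ι_injective {M : ModuleCat.{u} R} (I : InjectiveResolution M) :
    Function.Injective (I.ι.f 0).hom :=
  (ModuleCat.mono_iff_injective _).1 inferInstance

theorem InjectiveResolution.range_ι {M : ModuleCat.{u} R} (I : InjectiveResolution M) :
    LinearMap.range (I.ι.f 0).hom = cosyzygy I 0 := by
  have h : (ShortComplex.mk (I.ι.f 0) (I.cocomplex.d 0 1) I.ι_f_zero_comp_complex_d).Exact :=
    ShortComplex.exact_of_f_is_kernel _ I.isLimitKernelFork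
  exact (ShortComplex.moduleCat_exact_iff_range_eq_ker _).1 h

theorem InjectiveResolution.range_d {M : ModuleCat.{u} R} (I : InjectiveResolution M) (n : ℕ) :
    LinearMap.range (I.cocomplex.d n (n + 1)).hom = cosyzygy I (n + 1) :=
  (ShortComplex.moduleCat_exact_iff_range_eq_ker _).1 (I.exact_succ n)

/-- The module is isomorphic to its zeroth cosyzygy. -/
def InjectiveResolution.equivCosyzygyZero {M : ModuleCat.{u} R} (I : InjectiveResolution M) :
    M ≃ₗ[R] cosyzygy I 0 :=
  LinearEquiv.ofInjective (I.ι.f 0).hom (InjectiveResolution.ι_injective I) ≪≫ₗ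
    LinearEquiv.ofEq _ _ (InjectiveResolution.range_ι I)

/-- The next cosyzygy is the quotient of `I_n` by the current one. -/
def InjectiveResolution.quotEquiv {M : ModuleCat.{u} R} (I : InjectiveResolution M) (n : ℕ) :
    (I.cocomplex.X n ⧸ cosyzygy I n) ≃ₗ[R] cosyzygy I (n + 1) :=
  (I.cocomplex.d n (n + 1)).hom.quotKerEquivRange ≪≫ₗ
    LinearEquiv.ofEq _ _ (InjectiveResolution.range_d I n)

namespace HullSequence

variable (H : HullSequence R) {M : ModuleCat.{u} R}

/-- Matching the submodules, and not only the hulls, lets `Φ` descend to the quotients, which are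
the next cosyzygies; this drives the induction below. -/
theorem exists_equiv_E (I : InjectiveResolution M) (hI : IsMinimalResolution I) (n : ℕ)
    (e : cosyzygy I n ≃ₗ[R] H.C n) :
    ∃ Φ : I.cocomplex.X n ≃ₗ[R] H.E n,
      (cosyzygy I n).map (Φ : I.cocomplex.X n →ₗ[R] H.E n) = LinearMap.range (H.ι n) := by
  have := H.injective n
  have : Module.Injective R (I.cocomplex.X n) :=
    Module.injective_module_of_injective_object _ _ (inj := I.injective n)
  let φ := e ≪≫ₗ LinearEquiv.ofInjective (H.ι n) (H.ι_injective n)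
  obtain ⟨Φ, hΦ⟩ := exists_hull_equiv (hI n) (H.essential n) φ
  refine ⟨Φ, le_antisymm ?_ ?_⟩
  · rintro _ ⟨x, hx, rfl⟩
    have := hΦ ⟨x, hx⟩
    simp only at this
    rw [LinearEquiv.coe_coe, this]
    exact (φ _).2
  · intro y hy
    refine ⟨φ.symm ⟨y, hy⟩, (φ.symm ⟨y, hy⟩).2, ?_⟩
    rw [LinearEquiv.coe_coe, hΦ, LinearEquiv.apply_symm_apply]

theorem nonempty_cosyzygy_equiv (e : M ≃ₗ[R] H.C 0) (I : InjectiveResolution M)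
    (hI : IsMinimalResolution I) (n : ℕ) : Nonempty (cosyzygy I n ≃ₗ[R] H.C n) := by
  induction n with
  | zero => exact ⟨(InjectiveResolution.equivCosyzygyZero I).symm ≪≫ₗ e⟩
  | succ n ih =>
    obtain ⟨e'⟩ := ih
    obtain ⟨Φ, hΦ⟩ := H.exists_equiv_E I hI n e'
    refine ⟨(InjectiveResolution.quotEquiv I n).symm ≪≫ₗ Submodule.Quotient.equiv _ _ Φ hΦ ≪≫ₗ
      Submodule.quotEquivOfEq _ _ (LinearMap.exact_iff.1 (H.exact n)).symm ≪≫ₗ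
      (H.π n).quotKerEquivOfSurjective (H.π_surjective n)⟩

theorem nonempty_equiv_E (e : M ≃ₗ[R] H.C 0) (I : InjectiveResolution M)
    (hI : IsMinimalResolution I) (n : ℕ) : Nonempty (I.cocomplex.X n ≃ₗ[R] H.E n) := by
  obtain ⟨e'⟩ := H.nonempty_cosyzygy_equiv e I hI n
  obtain ⟨Φ, -⟩ := H.exists_equiv_E I hI n e'
  exact ⟨Φ⟩

/-- The complex obtained by splicing the short exact sequences. -/
def complex : CochainComplex (ModuleCat.{u} R) ℕ :=
  CochainComplex.of H.E (fun n => ModuleCat.ofHom (H.ι (n + 1) ∘ₗ H.π n)) fun n => by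
    ext x
    have : H.π (n + 1) (H.ι (n + 1) (H.π n x)) = 0 := (H.exact (n + 1)).apply_apply_eq_zero _
    simp [this]

theorem complex_d (n : ℕ) :
    H.complex.d n (n + 1) = ModuleCat.ofHom (H.ι (n + 1) ∘ₗ H.π n) :=
  CochainComplex.of_d H.E (fun n => ModuleCat.ofHom (H.ι (n + 1) ∘ₗ H.π n)) n

theorem ker_complex_d (n : ℕ) :
    LinearMap.ker (H.complex.d n (n + 1)).hom = LinearMap.range (H.ι n) := by
  rw [complex_d]
  change LinearMap.ker (H.ι (n + 1) ∘ₗ H.π n) = _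
  rw [LinearMap.ker_comp_of_ker_eq_bot _ (LinearMap.ker_eq_bot.2 (H.ι_injective _)),
    LinearMap.exact_iff.1 (H.exact n)]

theorem range_complex_d (n : ℕ) :
    LinearMap.range (H.complex.d n (n + 1)).hom = LinearMap.range (H.ι (n + 1)) := by
  rw [complex_d]
  change LinearMap.range (H.ι (n + 1) ∘ₗ H.π n) = _
  rw [LinearMap.range_comp_of_range_eq_top _ (LinearMap.range_eq_top.2 (H.π_surjective n))]

/-- The augmentation of the spliced complex. -/
def augmentation (e : M ≃ₗ[R] H.C 0) : (CochainComplex.single₀ (ModuleCat.{u} R)).obj M ⟶ H.complex :=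
  (CochainComplex.fromSingle₀Equiv _ _).symm ⟨ModuleCat.ofHom (H.ι 0 ∘ₗ e.toLinearMap), by
    rw [complex_d]
    ext x
    have : H.π 0 (H.ι 0 (e x)) = 0 := (H.exact 0).apply_apply_eq_zero _
    change H.ι 1 (H.π 0 (H.ι 0 (e x))) = 0
    rw [this, map_zero]⟩

theorem augmentation_f_zero (e : M ≃ₗ[R] H.C 0) :
    (H.augmentation e).f 0 = ModuleCat.ofHom (H.ι 0 ∘ₗ e.toLinearMap) :=
  congrArg Subtype.val ((CochainComplex.fromSingle₀Equiv H.complex M).apply_symm_apply _)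

/-- The injective resolution obtained by splicing the short exact sequences. -/
def resolution (e : M ≃ₗ[R] H.C 0) : InjectiveResolution M where
  cocomplex := H.complex
  injective n := by
    have := H.injective n
    exact Module.injective_object_of_injective_module R (H.E n)
  ι := H.augmentation e
  quasiIso := ⟨fun n => by
    cases n with
    | zero =>
      rw [CochainComplex.quasiIsoAt₀_iff, ShortComplex.quasiIso_iff_of_zeros]
      · refine ⟨(ShortComplex.moduleCat_exact_iff_range_eq_ker _).2 ?_,
          (ModuleCat.mono_iff_injective _).2 ?_⟩
        · change LinearMap.range ((H.augmentation e).f 0).hom = _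
          rw [augmentation_f_zero]
          exact (LinearMap.range_comp_of_range_eq_top _ e.range).trans (H.ker_complex_d 0).symm
        · change Function.Injective ((H.augmentation e).f 0).hom
          rw [augmentation_f_zero]
          exact (H.ι_injective 0).comp e.injective
      all_goals rfl
    | succ n =>
      rw [quasiIsoAt_iff_exactAt _ _ (CochainComplex.exactAt_succ_single_obj _ _),
        HomologicalComplex.exactAt_iff' _ n (n + 1) (n + 1 + 1) (by simp) (by simp)]
      exact (ShortComplex.moduleCat_exact_iff_range_eq_ker _).2
        ((H.range_complex_d n).trans (H.ker_complex_d (n + 1)).symm)⟩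

theorem isMinimalResolution (e : M ≃ₗ[R] H.C 0) : IsMinimalResolution (H.resolution e) := by
  intro n
  have h : cosyzygy (H.resolution e) n = LinearMap.range (H.ι n) := H.ker_complex_d n
  rw [h]
  exact H.essential n

/-- The supremum ranges over all minimal resolutions: the upper bound needs their uniqueness, the
lower bound the existence of one, namely the spliced resolution. -/
theorem moduleDomdim_eq (e : M ≃ₗ[R] H.C 0) (d : ℕ) (h : ∀ i < d, Module.Projective R (H.E i))
    (hd : ¬ Module.Projective R (H.E d)) : moduleDomdim M = d := by
  refine le_antisymm (iSup₂_le fun I hI => iSup₂_le fun n hn => ?_) ?_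
  · by_contra hlt
    have hdn : d < n := by exact_mod_cast not_le.1 hlt
    obtain ⟨Φ⟩ := H.nonempty_equiv_E e I hI d
    have := hn d hdn
    exact hd (Module.Projective.of_equiv Φ)
  · refine le_iSup₂_of_le (H.resolution e) (H.isMinimalResolution e) (le_iSup₂_of_le d ?_ le_rfl)
    intro i hi
    have := h i hi
    exact inferInstanceAs (Projective (H.E i))

theorem cosyzygyIso (e : M ≃ₗ[R] H.C 0) (n : ℕ) {N : Type u} [AddCommGroup N] [Module R N]
    (f : H.C n ≃ₗ[R] N) : CosyzygyIso M n N :=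
  ⟨⟨H.resolution e, H.isMinimalResolution e⟩, fun I hI => by
    obtain ⟨e'⟩ := H.nonempty_cosyzygy_equiv e I hI n
    exact ⟨e' ≪≫ₗ f⟩⟩

end HullSequence

end Resolutions

/-! ### Interval modules and the maps between them -/

theorem isPath_kupischA_iff {n : ℕ} {i j : Fin n} :
    (kupischA n).IsPath i j ↔ (i : ℕ) ≤ j ∧ (j : ℕ) < i + 3 := by
  -- At the last two vertices the Kupisch entry `n - i` only says `j < n`, so the bound `i + 3` is
  -- uniform.
  have := j.2
  simp only [LinearKupischSeries.IsPath, kupischA, Fin.le_def]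
  split_ifs <;> omega

/-- An interval `[lo, hi)` of at most three vertices of the linear quiver with `n` vertices. -/
@[ext]
structure Segment (n : ℕ) where
  lo : ℕ
  hi : ℕ
  lo_le : lo ≤ hi
  hi_le : hi ≤ n
  hi_le_lo : hi ≤ lo + 3

namespace Segment

variable {n : ℕ}

instance : Membership (Fin n) (Segment n) := ⟨fun s j => s.lo ≤ j ∧ (j : ℕ) < s.hi⟩

theorem mem_iff {s : Segment n} {j : Fin n} : j ∈ s ↔ s.lo ≤ j ∧ (j : ℕ) < s.hi := Iff.rfl

instance (s : Segment n) (j : Fin n) : Decidable (j ∈ s) := inferInstanceAs (Decidable (_ ∧ _))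

end Segment

/-- The families of rows indexed by `ι` whose row `r` is supported in the segment `S r`. -/
def rowSpace (K : Type u) [Field K] {n : ℕ} {ι : Type} (S : ι → Segment n) :
    Submodule K (ι → Fin n → K) where
  carrier := {f | ∀ r j, j ∉ S r → f r j = 0}
  add_mem' {f g} hf hg r j h := by simp [hf r j h, hg r j h]
  zero_mem' _ _ _ := rfl
  smul_mem' a f hf r j h := by simp [hf r j h]

/-- The direct sum of the interval modules over `A_n` with supports `S r`. -/
def RowModule (K : Type u) [Field K] {n : ℕ} {ι : Type} (S : ι → Segment n) : Type u :=
  rowSpace K S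

namespace RowModule

variable {K : Type u} [Field K] {n : ℕ} {ι : Type} {S T : ι → Segment n}

instance : AddCommGroup (RowModule K S) := inferInstanceAs (AddCommGroup (rowSpace K S))

instance : Module K (RowModule K S) := inferInstanceAs (Module K (rowSpace K S))

/-- The entries of an element. -/
def coeff (f : RowModule K S) : ι → Fin n → K := f.1

theorem coeff_eq_zero (f : RowModule K S) {r : ι} {j : Fin n} (h : j ∉ S r) : f.coeff r j = 0 :=
  f.2 r j h

theorem mem_of_coeff_ne_zero {f : RowModule K S} {r : ι} {j : Fin n} (h : f.coeff r j ≠ 0) :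
    j ∈ S r := by
  by_contra h'
  exact h (f.coeff_eq_zero h')

@[ext]
theorem ext {f g : RowModule K S} (h : ∀ r j, j ∈ S r → f.coeff r j = g.coeff r j) : f = g := by
  refine Subtype.ext (funext fun r => funext fun j => ?_)
  by_cases hp : j ∈ S r
  · exact h r j hp
  · exact (f.2 r j hp).trans (g.2 r j hp).symm

@[simp] theorem coeff_add (f g : RowModule K S) : (f + g).coeff = f.coeff + g.coeff := rfl

@[simp] theorem coeff_zero : (0 : RowModule K S).coeff = 0 := rfl

@[simp] theorem coeff_smul (a : K) (f : RowModule K S) : (a • f).coeff = a • f.coeff := rfl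

@[simp] theorem coeff_sum {κ : Type*} (s : Finset κ) (f : κ → RowModule K S) :
    (∑ i ∈ s, f i).coeff = ∑ i ∈ s, (f i).coeff :=
  map_sum (rowSpace K S).subtype f s

/-- The element of a row module obtained by restricting a family of rows to the supports. -/
def mk (f : ι → Fin n → K) : RowModule K S :=
  ⟨fun r j => if j ∈ S r then f r j else 0, fun _ _ h => if_neg h⟩

theorem coeff_mk (f : ι → Fin n → K) (r : ι) (j : Fin n) :
    (mk f : RowModule K S).coeff r j = if j ∈ S r then f r j else 0 := rfl

instance : SMul (AlgA K n)ᵐᵒᵖ (RowModule K S) :=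
  ⟨fun x f => mk fun r k => ∑ j, f.coeff r j * x.unop.coeff j k⟩

theorem coeff_op_smul (x : (AlgA K n)ᵐᵒᵖ) (f : RowModule K S) (r : ι) (k : Fin n) :
    (x • f).coeff r k = if k ∈ S r then ∑ j, f.coeff r j * x.unop.coeff j k else 0 := rfl

theorem coeff_op_smul_of_mem (x : (AlgA K n)ᵐᵒᵖ) (f : RowModule K S) {r : ι} {k : Fin n}
    (h : k ∈ S r) : (x • f).coeff r k = ∑ j, f.coeff r j * x.unop.coeff j k := if_pos h

protected theorem mul_smul (x y : (AlgA K n)ᵐᵒᵖ) (f : RowModule K S) :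
    (x * y) • f = x • y • f := by
  ext r k hk
  rw [coeff_op_smul_of_mem _ _ hk, coeff_op_smul_of_mem _ _ hk]
  have hl : ∀ i, f.coeff r i * (x * y).unop.coeff i k
      = f.coeff r i * ∑ j, y.unop.coeff i j * x.unop.coeff j k := by
    intro i
    by_cases hi : i ∈ S r
    · by_cases hik : i ≤ k
      -- A segment has at most three vertices, so every path inside it is nonzero in the algebra.
      · have : (kupischA n).IsPath i k := by
          rw [isPath_kupischA_iff]
          have := (S r).hi_le_lo
          exact ⟨hik, by have := hk.2; have := hi.1; omega⟩
        rw [MulOpposite.unop_mul, NakayamaAlgebra.coeff_mul _ _ this]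
      · rw [NakayamaAlgebra.mul_coeff_eq_zero _ _ hik,
          NakayamaAlgebra.coeff_eq_zero _ fun h => hik h.1]
    · rw [f.coeff_eq_zero hi, zero_mul, zero_mul]
  have hr : ∀ j, (y • f).coeff r j * x.unop.coeff j k
      = (∑ i, f.coeff r i * y.unop.coeff i j) * x.unop.coeff j k := by
    intro j
    by_cases hj : j ∈ S r
    · rw [coeff_op_smul_of_mem _ _ hj]
    · rw [coeff_eq_zero _ hj, zero_mul]
      by_cases hjk : (kupischA n).IsPath j k
      -- A path that leaves the segment cannot re-enter it: `i ≤ j ≤ k` with both ends in the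
      -- segment would put `j` there too.
      · rw [Finset.sum_eq_zero, zero_mul]
        intro i _
        by_cases hi : i ∈ S r
        · rw [NakayamaAlgebra.coeff_eq_zero, mul_zero]
          intro hij
          have h1 : (i : ℕ) ≤ j := hij.1
          have h2 : (j : ℕ) ≤ k := hjk.1
          exact hj ⟨hi.1.trans h1, h2.trans_lt hk.2⟩
        · rw [f.coeff_eq_zero hi, zero_mul]
      · rw [NakayamaAlgebra.coeff_eq_zero _ hjk, mul_zero]
  rw [Finset.sum_congr rfl fun i _ => hl i, Finset.sum_congr rfl fun j _ => hr j]
  simp_rw [Finset.sum_mul, Finset.mul_sum]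
  rw [Finset.sum_comm]
  simp_rw [mul_assoc]

instance : Module (AlgA K n)ᵐᵒᵖ (RowModule K S) where
  one_smul f := by ext r j h; simp [coeff_op_smul_of_mem _ _ h, Matrix.one_apply]
  mul_smul := RowModule.mul_smul
  smul_zero x := by ext r j h; simp [coeff_op_smul_of_mem _ _ h]
  zero_smul f := by ext r j h; simp [coeff_op_smul_of_mem _ _ h]
  smul_add x f g := by
    ext r j h; simp [coeff_op_smul_of_mem _ _ h, add_mul, Finset.sum_add_distrib]
  add_smul x y f := by
    ext r j h; simp [coeff_op_smul_of_mem _ _ h, mul_add, Finset.sum_add_distrib]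

theorem algebraMap_smul' (a : K) (f : RowModule K S) :
    algebraMap K (AlgA K n)ᵐᵒᵖ a • f = a • f := by
  ext r j h
  rw [coeff_op_smul_of_mem _ _ h, MulOpposite.algebraMap_apply, MulOpposite.unop_op,
    Algebra.algebraMap_eq_smul_one]
  simp [Matrix.one_apply, mul_comm]

instance : IsScalarTower K (AlgA K n)ᵐᵒᵖ (RowModule K S) :=
  IsScalarTower.of_algebraMap_smul algebraMap_smul'

/-- Restriction of rows to segments that begin and end to the left of the given ones. -/
def trunc (S T : ι → Segment n) (hlo : ∀ r, (T r).lo ≤ (S r).lo) (hhi : ∀ r, (T r).hi ≤ (S r).hi) :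
    RowModule K S →ₗ[(AlgA K n)ᵐᵒᵖ] RowModule K T where
  toFun f := mk f.coeff
  map_add' f g := by ext r j h; simp [coeff_mk, h]
  map_smul' x f := by
    ext r k hk
    rw [RingHom.id_apply, coeff_mk, if_pos hk, coeff_op_smul_of_mem _ _ hk, coeff_op_smul]
    have key : ∀ j, (mk f.coeff : RowModule K T).coeff r j * x.unop.coeff j k
        = f.coeff r j * x.unop.coeff j k := by
      intro j
      rw [coeff_mk]
      split_ifs with hj
      · rfl
      · by_cases hjS : j ∈ S r
        · rw [NakayamaAlgebra.coeff_eq_zero, mul_zero, mul_zero]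
          intro hjk
          have h1 : (j : ℕ) ≤ k := hjk.1
          exact hj ⟨(hlo r).trans hjS.1, h1.trans_lt hk.2⟩
        · rw [f.coeff_eq_zero hjS]
    rw [Finset.sum_congr rfl fun j _ => key j]
    split_ifs with hkS
    · rfl
    · symm
      refine Finset.sum_eq_zero fun j _ => ?_
      by_cases hjS : j ∈ S r
      · rw [NakayamaAlgebra.coeff_eq_zero, mul_zero]
        intro hjk
        have h1 : (j : ℕ) ≤ k := hjk.1
        exact hkS ⟨hjS.1.trans h1, hk.2.trans_le (hhi r)⟩
      · rw [f.coeff_eq_zero hjS, zero_mul]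

theorem coeff_trunc {hlo : ∀ r, (T r).lo ≤ (S r).lo} {hhi : ∀ r, (T r).hi ≤ (S r).hi}
    (f : RowModule K S) (r : ι) (j : Fin n) :
    (trunc S T hlo hhi f).coeff r j = if j ∈ T r then f.coeff r j else 0 := rfl

theorem trunc_injective {hlo : ∀ r, (T r).lo ≤ (S r).lo} (h : ∀ r, (T r).hi = (S r).hi) :
    Function.Injective (trunc (K := K) S T hlo fun r => (h r).le) := by
  intro f g hfg
  ext r j hj
  have := congrFun (congrFun (congrArg coeff hfg) r) j
  have hjT : j ∈ T r := ⟨(hlo r).trans hj.1, hj.2.trans_le (h r).ge⟩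
  simpa [coeff_trunc, hjT] using this

/-- A nonempty target row must have the same top as its source. An empty one may sit anywhere,
whence the guarded hypothesis. -/
theorem trunc_surjective {hhi : ∀ r, (T r).hi ≤ (S r).hi}
    (h : ∀ r, (T r).lo < (T r).hi → (T r).lo = (S r).lo) (hlo : ∀ r, (T r).lo ≤ (S r).lo) :
    Function.Surjective (trunc (K := K) S T hlo hhi) := by
  intro g
  refine ⟨mk g.coeff, ?_⟩
  ext r j hj
  have hjS : j ∈ S r := ⟨(h r (hj.1.trans_lt hj.2)).ge.trans hj.1, hj.2.trans_le (hhi r)⟩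
  simp [coeff_trunc, coeff_mk, hj, hjS]

/-- A segment `[b, c)` cut into `[b, a)` and `[a, c)` gives a short exact sequence. -/
theorem exact_trunc {U : ι → Segment n} (hlo : ∀ r, (T r).lo ≤ (S r).lo)
    (hhi : ∀ r, (T r).hi = (S r).hi) (hlo' : ∀ r, (U r).lo = (T r).lo)
    (hhi' : ∀ r, (U r).hi = (S r).lo) :
    Function.Exact (trunc (K := K) S T hlo fun r => (hhi r).le)
      (trunc (K := K) T U (fun r => (hlo' r).le)
        fun r => (hhi' r).trans_le ((S r).lo_le.trans (hhi r).ge)) := by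
  intro g
  constructor
  · intro hg
    refine ⟨mk g.coeff, ?_⟩
    ext r j hj
    by_cases hjS : j ∈ S r
    · simp [coeff_trunc, coeff_mk, hj, hjS]
    · have hjU : j ∈ U r := by
        simp only [Segment.mem_iff, hlo', hhi', hhi] at hj hjS ⊢
        omega
      have := congrFun (congrFun (congrArg coeff hg) r) j
      rw [coeff_trunc, if_pos hjU] at this
      simp [coeff_trunc, coeff_mk, hj, hjS, this]
  · rintro ⟨f, rfl⟩
    ext r j hj
    have hjS : j ∉ S r := by
      simp only [Segment.mem_iff, hlo', hhi'] at hj ⊢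
      omega
    simp [coeff_trunc, f.coeff_eq_zero hjS]

end RowModule


/-! ### The action of paths; essential, injective and projective row modules -/

namespace NakayamaAlgebra

variable {K : Type u} [Field K] {n : ℕ}

/-- The path from `i` to `j` if it exists and is nonzero, and `0` otherwise. -/
def path (i j : ℕ) : AlgA K n :=
  ⟨Matrix.of fun a b => if (a : ℕ) = i ∧ (b : ℕ) = j ∧ i ≤ j ∧ j < i + 3 then 1 else 0,
    fun a b h => if_neg fun h' => h (isPath_kupischA_iff.2 (by omega))⟩

theorem coeff_path (i j : ℕ) (a b : Fin n) : (path i j : AlgA K n).coeff a b =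
    if (a : ℕ) = i ∧ (b : ℕ) = j ∧ i ≤ j ∧ j < i + 3 then 1 else 0 := rfl

theorem path_eq_zero {i j : ℕ} (h : ¬ (i ≤ j ∧ j < i + 3)) : (path i j : AlgA K n) = 0 := by
  ext a b _
  rw [coeff_path, if_neg fun h' => h h'.2.2]
  rfl

theorem coeff_finset_sum {c : LinearKupischSeries n} {κ : Type*} (s : Finset κ)
    (f : κ → NakayamaAlgebra K c) : (∑ i ∈ s, f i).coeff = ∑ i ∈ s, (f i).coeff :=
  map_sum (pathSpace K c).subtype f s

/-- Right multiplication with a path moves a column. -/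
theorem mul_path (a : AlgA K n) (k : Fin n) (l : ℕ) (hkl : (k : ℕ) ≤ l) (hl : l < k + 3) :
    a * path k l = ∑ i : Fin n, a.coeff i k • path i l := by
  ext x y hxy
  rw [coeff_mul _ _ hxy, coeff_finset_sum, Matrix.sum_apply]
  simp only [coeff_smul, Matrix.smul_apply, smul_eq_mul, coeff_path]
  rw [Finset.sum_eq_single k, Finset.sum_eq_single x]
  · have h := isPath_kupischA_iff.1 hxy
    by_cases hy : (y : ℕ) = l
    · rw [if_pos ⟨rfl, hy, hkl, hl⟩, if_pos ⟨rfl, hy, by omega, by omega⟩]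
    · rw [if_neg fun h => hy h.2.1, if_neg fun h => hy h.2.1]
  · intro b _ hb
    rw [if_neg fun h => hb (Fin.ext h.1.symm), mul_zero]
  · simp
  · intro b _ hb
    rw [if_neg fun h => hb (Fin.ext h.1), mul_zero]
  · simp

end NakayamaAlgebra

namespace RowModule

open NakayamaAlgebra MulOpposite

variable {K : Type u} [Field K] {n : ℕ} {ι : Type} {S T : ι → Segment n}

theorem coeff_path_smul (f : RowModule K S) (i : Fin n) (l : ℕ) (r : ι) (k : Fin n) :
    (op (path (i : ℕ) l : AlgA K n) • f).coeff r k =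
      if k ∈ S r ∧ (k : ℕ) = l ∧ (i : ℕ) ≤ l ∧ l < i + 3 then f.coeff r i else 0 := by
  rw [coeff_op_smul, ite_and]
  congr 1
  simp only [unop_op, coeff_path]
  rw [Finset.sum_eq_single i]
  · simp
  · intro b _ hb
    rw [if_neg fun h => hb (Fin.ext h.1), mul_zero]
  · simp

/-- A submodule is essential if it contains all elements supported in the ends of the rows. -/
theorem isEssentialSubmodule_of_socle_le {N : Submodule (AlgA K n)ᵐᵒᵖ (RowModule K S)}
    (hN : ∀ f : RowModule K S, (∀ r j, f.coeff r j ≠ 0 → (S r).hi ≤ j + 1) → f ∈ N) :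
    IsEssentialSubmodule N := by
  intro L hL
  -- Induction on the distance of the support from the row ends. An arrow moves an element of `L`
  -- one step closer, so its image vanishes; hence the element already lay in the socle, thus in `N
  -- ⊓ L`.
  have key : ∀ k : ℕ, ∀ f ∈ L, (∀ r j, f.coeff r j ≠ 0 → (S r).hi ≤ j + 1 + k) → f = 0 := by
    intro k
    induction k with
    | zero =>
      intro f hf h
      exact (Submodule.mem_bot _).1 (hL ▸ Submodule.mem_inf.2 ⟨hN f h, hf⟩)
    | succ k ih =>
      intro f hf h
      refine (Submodule.mem_bot _).1 (hL ▸ Submodule.mem_inf.2 ⟨hN f fun r j hj => ?_, hf⟩)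
      by_contra hlt
      have hmem := mem_of_coeff_ne_zero hj
      have hjn : (j : ℕ) + 1 < n := by have := (S r).hi_le; omega
      have h0 := ih (op (path (j : ℕ) (j + 1) : AlgA K n) • f) (L.smul_mem _ hf) fun r' j' h' => by
        rw [coeff_path_smul] at h'
        split_ifs at h' with h1
        · have := h r' j h'
          omega
        · exact absurd rfl h'
      have h1 := congrFun (congrFun (congrArg coeff h0) r) ⟨j + 1, hjn⟩
      rw [coeff_path_smul, if_pos] at h1
      · exact hj h1
      · refine ⟨⟨?_, ?_⟩, rfl, by omega, by omega⟩
        · have := hmem.1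
          simp only
          omega
        · simp only
          omega
  refine eq_bot_iff.2 fun f hf => (Submodule.mem_bot _).2 (key n f hf fun r j _ => ?_)
  have := (S r).hi_le
  omega

/-- A row module is injective if all its nonempty rows begin as far to the left as possible. -/
theorem injective_of_lo (h : ∀ r, (S r).lo < (S r).hi → (S r).lo = (S r).hi - 3) :
    Module.Injective (AlgA K n)ᵐᵒᵖ (RowModule K S) := by
  constructor
  intro X Y _ _ _ _ f hf g
  let _ : Module K X := Module.compHom X (algebraMap K (AlgA K n)ᵐᵒᵖ)
  let _ : Module K Y := Module.compHom Y (algebraMap K (AlgA K n)ᵐᵒᵖ)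
  let f' : X →ₗ[K] Y :=
    { toFun := f, map_add' := f.map_add, map_smul' := fun a x => f.map_smul _ x }
  let g' : X →ₗ[K] (ι → Fin n → K) :=
    { toFun := fun x => (g x).coeff
      map_add' := fun x y => by rw [map_add, coeff_add]
      map_smul' := fun a x => by
        have : g (a • x) = a • g x := (g.map_smul _ x).trans (algebraMap_smul' a _)
        rw [this, coeff_smul, RingHom.id_apply] }
  obtain ⟨p, hp⟩ := LinearMap.exists_leftInverse_of_injective f' (LinearMap.ker_eq_bot.2 hf)
  let φ : Y →ₗ[K] (ι → Fin n → K) := g' ∘ₗ p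
  have hφ : ∀ x, φ (f x) = (g x).coeff := fun x =>
    congrArg g' (LinearMap.congr_fun hp x : p (f' x) = x)
  have hlast : ∀ {r : ι} {j : Fin n}, j ∈ S r → (S r).hi - 1 < n := fun {r j} hj => by
    have := (S r).hi_le
    have := hj.2
    omega
  -- The row ending at `hi` is the dual of the left module $Ae_{hi-1}$, so a map into it is
  -- determined by a linear form on the vertex space at `hi - 1`. The merely `K`-linear extension
  -- `φ` supplies that form, and the other coordinates are read off after moving along the path to
  -- `hi - 1`.
  let G : Y → ι → Fin n → K := fun y r i =>
    if hi : i ∈ S r then φ (op (path (i : ℕ) ((S r).hi - 1) : AlgA K n) • y) r ⟨_, hlast hi⟩ else 0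
  have hG : ∀ y r i (hi : i ∈ S r), (mk (G y) : RowModule K S).coeff r i =
      φ (op (path (i : ℕ) ((S r).hi - 1) : AlgA K n) • y) r ⟨_, hlast hi⟩ := fun y r i hi => by
    rw [coeff_mk, if_pos hi]
    exact dif_pos hi
  have hlast' : ∀ {r : ι} {i : Fin n} (hi : i ∈ S r), (i : ℕ) ≤ (S r).hi - 1 ∧
      (S r).hi - 1 < i + 3 := fun {r i} hi => by
    have h1 := h r (hi.1.trans_lt hi.2)
    have := hi.1
    have := hi.2
    omega
  refine ⟨{ toFun := fun y => mk (G y), map_add' := fun y z => ?_, map_smul' := fun a y => ?_ },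
    fun x => ?_⟩
  · ext r i hi
    rw [coeff_add, Pi.add_apply, Pi.add_apply, hG _ _ _ hi, hG _ _ _ hi, hG _ _ _ hi, smul_add,
      map_add, Pi.add_apply, Pi.add_apply]
  · ext r k hk
    rw [RingHom.id_apply, coeff_op_smul_of_mem _ _ hk, hG _ _ _ hk, ← mul_smul]
    have h1 : op (path (k : ℕ) ((S r).hi - 1) : AlgA K n) * a
        = ∑ i : Fin n, op (a.unop.coeff i k • path (i : ℕ) ((S r).hi - 1)) := by
      rw [← Finset.op_sum, ← mul_path _ _ _ (hlast' hk).1 (hlast' hk).2]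
      rfl
    have h2 : ∀ i : Fin n, op (a.unop.coeff i k • path (i : ℕ) ((S r).hi - 1) : AlgA K n) • y
        = a.unop.coeff i k • op (path (i : ℕ) ((S r).hi - 1) : AlgA K n) • y := by
      intro i
      rw [op_smul, Algebra.smul_def, mul_smul]
      rfl
    rw [h1, Finset.sum_smul, map_sum, Finset.sum_apply, Finset.sum_apply]
    refine Finset.sum_congr rfl fun i _ => ?_
    rw [h2, map_smul, Pi.smul_apply, Pi.smul_apply, smul_eq_mul, mul_comm]
    by_cases hi : i ∈ S r
    · rw [hG _ _ _ hi]
    · rw [coeff_eq_zero _ hi, zero_mul]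
      by_cases hik : (kupischA n).IsPath i k
      -- Here the hypothesis on `lo` enters: a vertex to the left of the row has distance at least
      -- three from its end.
      · rw [path_eq_zero, MulOpposite.op_zero, zero_smul, map_zero, Pi.zero_apply, Pi.zero_apply, zero_mul]
        have h3 : (i : ℕ) ≤ k := hik.1
        have h4 := hk.2
        have h5 := h r (hk.1.trans_lt hk.2)
        rw [Segment.mem_iff] at hi
        omega
      · rw [NakayamaAlgebra.coeff_eq_zero _ hik, mul_zero]
  · ext r i hi
    change (mk (G (f x)) : RowModule K S).coeff r i = _
    rw [hG _ _ _ hi, ← map_smul, hφ, map_smul, coeff_path_smul, if_pos]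
    refine ⟨⟨?_, ?_⟩, rfl, hlast' hi⟩
    · exact hi.1.trans (hlast' hi).1
    · have := hi.2
      simp only
      omega

/-- A row module is projective if all its nonempty rows end as far to the right as possible. -/
theorem projective_of_hi [Fintype ι]
    (h : ∀ r, (S r).lo < (S r).hi → (S r).hi = min ((S r).lo + 3) n) :
    Module.Projective (AlgA K n)ᵐᵒᵖ (RowModule K S) := by
  classical
  refine Module.Projective.of_lifting_property'' fun f hf => ?_
  -- `x r` lifts the generator of row `r`. Since the row is all of $e_{lo}A$, its elements can be
  -- written as matrices `R r p` with a single row, and `p ↦ ∑ x r · R r p` is a section.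
  choose x hx using fun r => hf (mk fun r' (j : Fin n) => if r' = r ∧ (j : ℕ) = (S r).lo then 1 else 0)
  let R (r : ι) (p : RowModule K S) : AlgA K n :=
    ⟨Matrix.of fun a b => if (a : ℕ) = (S r).lo then p.coeff r b else 0, fun a b hab => by
      rw [Matrix.of_apply]
      split_ifs with ha
      · refine p.coeff_eq_zero fun hb => hab (isPath_kupischA_iff.2 ?_)
        have := hb.1
        have := hb.2
        have := (S r).hi_le_lo
        omega
      · rfl⟩
  have hR : ∀ r p a b, (R r p).coeff a b = if (a : ℕ) = (S r).lo then p.coeff r b else 0 :=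
    fun _ _ _ _ => rfl
  refine ⟨{ toFun := fun p => ∑ r, op (R r p) • x r, map_add' := fun p q => ?_,
            map_smul' := fun a p => ?_ }, LinearMap.ext fun p => ?_⟩
  · rw [← Finset.sum_add_distrib]
    refine Finset.sum_congr rfl fun r _ => ?_
    rw [← add_smul, ← MulOpposite.op_add]
    congr 2
    ext a b _
    simp only [hR, NakayamaAlgebra.coeff_add, Matrix.add_apply]
    split_ifs
    · rfl
    · rw [add_zero]
  · rw [RingHom.id_apply, Finset.smul_sum]
    refine Finset.sum_congr rfl fun r _ => ?_
    rw [← mul_smul]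
    congr 1
    refine unop_injective ?_
    rw [unop_op, unop_mul, unop_op]
    ext c b hcb
    rw [coeff_mul _ _ hcb, hR]
    simp only [hR]
    split_ifs with hc
    · rw [coeff_op_smul]
      split_ifs with hb
      · rfl
      · symm
        refine Finset.sum_eq_zero fun j _ => ?_
        rw [isPath_kupischA_iff] at hcb
        rw [p.coeff_eq_zero, zero_mul]
        intro hj
        have h1 := h r (hj.1.trans_lt hj.2)
        have := b.2
        rw [Segment.mem_iff] at hb
        omega
    · simp
  · rw [LinearMap.comp_apply, LinearMap.id_apply]
    change f (∑ r, op (R r p) • x r) = p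
    rw [map_sum]
    ext r k hk
    rw [coeff_sum, Finset.sum_apply, Finset.sum_apply, Finset.sum_eq_single r]
    · have hlo : (S r).lo < n := by have := hk.1; omega
      rw [map_smul, hx, coeff_op_smul_of_mem _ _ hk, Finset.sum_eq_single ⟨(S r).lo, hlo⟩]
      · rw [coeff_mk, if_pos, if_pos ⟨rfl, rfl⟩, unop_op, hR, if_pos rfl, one_mul]
        exact ⟨le_rfl, hk.1.trans_lt hk.2⟩
      · intro b _ hb
        rw [coeff_mk, if_neg (c := r = r ∧ _), ite_self, zero_mul]
        exact fun h => hb (Fin.ext h.2)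
      · simp
    · intro r' _ hr'
      rw [map_smul, hx, coeff_op_smul_of_mem _ _ hk]
      refine Finset.sum_eq_zero fun j _ => ?_
      rw [coeff_mk, if_neg (c := r = r' ∧ _), ite_self, zero_mul]
      exact fun h => hr' h.1.symm
    · simp

end RowModule

/-! ### Projective covers, injective hulls and the resolutions built from them -/

/-- The projective cover of an interval module. -/
def Segment.cover {n : ℕ} (s : Segment n) : Segment n where
  lo := s.lo
  hi := if s.lo < s.hi then min (s.lo + 3) n else s.hi
  lo_le := by have := s.lo_le; have := s.hi_le; split_ifs <;> omega
  hi_le := by have := s.hi_le; split_ifs <;> omega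
  hi_le_lo := by have := s.hi_le_lo; split_ifs <;> omega

theorem Segment.lo_le_cover {n : ℕ} (s : Segment n) : s.lo ≤ s.cover.lo := le_rfl

theorem Segment.hi_le_cover {n : ℕ} (s : Segment n) : s.hi ≤ s.cover.hi := by
  have := s.hi_le
  have := s.hi_le_lo
  simp only [Segment.cover]
  split_ifs <;> omega

namespace RowModule

open NakayamaAlgebra MulOpposite

variable {K : Type u} [Field K] {n : ℕ} {ι : Type} {S T : ι → Segment n}

/-- Otherwise the projective cover would split. The path from `lo` to `hi` kills the generator `g`
of the row, but not its lift, which has coefficient `1` at `lo` in a cover that still contains `hi`.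
-/
theorem not_projective {r : ι} (hr : (S r).lo < (S r).hi) (h : (S r).hi < min ((S r).lo + 3) n) :
    ¬ Module.Projective (AlgA K n)ᵐᵒᵖ (RowModule K S) := by
  classical
  intro hP
  obtain ⟨s, hs⟩ := Module.projective_lifting_property
    (trunc (K := K) (fun r => (S r).cover) S (fun r => (S r).lo_le_cover) fun r => (S r).hi_le_cover)
    LinearMap.id
    (trunc_surjective (S := fun r => (S r).cover) (T := S) (fun _ _ => rfl) fun _ => le_rfl)
  have hlo : (S r).lo < n := by omega
  have hhi : (S r).hi < n := by omega
  have hmem : (⟨(S r).lo, hlo⟩ : Fin n) ∈ S r := ⟨le_rfl, hr⟩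
  let g : RowModule K S := mk fun r' j => if r' = r ∧ (j : ℕ) = (S r).lo then 1 else 0
  let p : (AlgA K n)ᵐᵒᵖ := op (path ((⟨(S r).lo, hlo⟩ : Fin n) : ℕ) (S r).hi)
  have hg : p • g = 0 := by
    ext r' k hk
    rw [coeff_path_smul, coeff_zero, Pi.zero_apply, Pi.zero_apply]
    split_ifs with hk'
    · rw [coeff_mk, if_neg (c := r' = r ∧ _), ite_self]
      rintro ⟨rfl, -⟩
      exact hk.2.ne hk'.2.1
    · rfl
  have h1 := congrFun (congrFun (congrArg coeff (LinearMap.congr_fun hs g)) r) ⟨(S r).lo, hlo⟩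
  rw [LinearMap.comp_apply, coeff_trunc, if_pos hmem, LinearMap.id_apply, coeff_mk, if_pos hmem,
    if_pos ⟨rfl, rfl⟩] at h1
  have h2 : (p • s g).coeff r ⟨(S r).hi, hhi⟩ = 0 := by rw [← map_smul, hg, map_zero]; rfl
  rw [coeff_path_smul, if_pos, h1] at h2
  · exact one_ne_zero h2
  · refine ⟨⟨hr.le, ?_⟩, rfl, hr.le, by simp only; omega⟩
    simp only [Segment.cover, if_pos hr]
    exact h

end RowModule

namespace Segment

variable {n : ℕ}

/-- The injective hull of an interval module. -/
def hull (s : Segment n) : Segment n where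
  -- Truncated subtraction stops the hull at vertex `0`. An empty segment is left alone, so that its
  -- cosyzygies stay empty.
  lo := if s.lo < s.hi then s.hi - 3 else s.lo
  hi := s.hi
  lo_le := by have := s.lo_le; split_ifs <;> omega
  hi_le := s.hi_le
  hi_le_lo := by have := s.hi_le_lo; split_ifs <;> omega

theorem hull_lo_le (s : Segment n) : s.hull.lo ≤ s.lo := by
  have := s.hi_le_lo
  simp only [hull]
  split_ifs <;> omega

/-- The cokernel of an interval module in its injective hull. -/
def cosyzygy (s : Segment n) : Segment n where
  lo := s.hull.lo
  hi := s.lo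
  lo_le := s.hull_lo_le
  hi_le := s.lo_le.trans s.hi_le
  hi_le_lo := s.lo_le.trans s.hull.hi_le_lo

/-- The kernel of the projective cover of an interval module. -/
def syzygy (s : Segment n) : Segment n where
  lo := s.hi
  hi := s.cover.hi
  lo_le := s.hi_le_cover
  hi_le := s.cover.hi_le
  hi_le_lo := s.cover.hi_le_lo.trans (Nat.add_le_add_right s.lo_le 3)

/-- The `k`-th cosyzygy of an interval module. -/
def nthCosyzygy (s : Segment n) : ℕ → Segment n
  | 0 => s
  | k + 1 => (nthCosyzygy s k).cosyzygy

/-- The support of the simple module at the vertex `c`, which is empty if there is no such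
vertex. -/
def simple (n c : ℕ) : Segment n where
  lo := min c n
  hi := min (c + 1) n
  lo_le := by omega
  hi_le := by omega
  hi_le_lo := by omega

end Segment

namespace RowModule

variable {K : Type u} [Field K] {n : ℕ} {ι : Type}

/-- The minimal injective resolution of a row module. -/
def hullSequence (K : Type u) [Field K] (S : ι → Segment n) :
    HullSequence.{u} (AlgA K n)ᵐᵒᵖ where
  C k := ModuleCat.of _ (RowModule K fun r => (S r).nthCosyzygy k)
  E k := ModuleCat.of _ (RowModule K fun r => ((S r).nthCosyzygy k).hull)
  ι _ := trunc _ _ (fun _ => Segment.hull_lo_le _) fun _ => le_rfl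
  π _ := trunc _ _ (fun _ => le_rfl) fun _ => Segment.lo_le _
  ι_injective k := trunc_injective (S := fun r => (S r).nthCosyzygy k)
    (T := fun r => ((S r).nthCosyzygy k).hull) (hlo := fun _ => Segment.hull_lo_le _) fun _ => rfl
  exact k := exact_trunc (S := fun r => (S r).nthCosyzygy k)
    (T := fun r => ((S r).nthCosyzygy k).hull) (U := fun r => (S r).nthCosyzygy (k + 1))
    (fun _ => Segment.hull_lo_le _) (fun _ => rfl) (fun _ => rfl) fun _ => rfl
  π_surjective k := trunc_surjective (S := fun r => ((S r).nthCosyzygy k).hull)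
    (T := fun r => (S r).nthCosyzygy (k + 1)) (fun _ _ => rfl) fun _ => le_rfl
  injective k := by
    refine injective_of_lo fun r hr => ?_
    simp only [Segment.hull] at hr ⊢
    split_ifs at hr ⊢
    · rfl
    · omega
  essential k := by
    -- A nonempty segment and its hull have the same right end, hence the same socle.
    refine isEssentialSubmodule_of_socle_le fun f hf => ⟨mk f.coeff, ?_⟩
    ext r j hj
    refine (coeff_trunc _ r j).trans ?_
    rw [if_pos hj, coeff_mk, ite_eq_left_iff]
    intro hj'
    by_contra h0
    have h1 := hf r j (Ne.symm h0)
    refine hj' ⟨?_, hj.2⟩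
    have h2 : ((S r).nthCosyzygy k).lo < ((S r).nthCosyzygy k).hi := by
      by_contra hlt
      have h3 := hj.1
      have h4 := hj.2
      simp only [Segment.hull, if_neg hlt] at h3 h4
      omega
    have h3 : ((S r).nthCosyzygy k).hi ≤ j + 1 := h1
    omega

variable {S : ι → Segment n}

theorem moduleDomdim_eq [Fintype ι] {M : ModuleCat.{u} (AlgA K n)ᵐᵒᵖ}
    (e : M ≃ₗ[(AlgA K n)ᵐᵒᵖ] RowModule K S) (d : ℕ)
    (h : ∀ i < d, ∀ r, ((S r).nthCosyzygy i).lo < ((S r).nthCosyzygy i).hi →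
      3 ≤ ((S r).nthCosyzygy i).hi)
    (hd : ∃ r, ((S r).nthCosyzygy d).lo < ((S r).nthCosyzygy d).hi ∧
      ((S r).nthCosyzygy d).hi < min 3 n) : moduleDomdim M = d := by
  refine (hullSequence K S).moduleDomdim_eq e d (fun i hi => ?_) ?_
  · suffices h : Module.Projective (AlgA K n)ᵐᵒᵖ
        (RowModule K fun r => ((S r).nthCosyzygy i).hull) from h
    refine projective_of_hi fun r hr => ?_
    have h1 := h i hi r
    have h2 := ((S r).nthCosyzygy i).hi_le
    simp only [Segment.hull] at hr ⊢
    split_ifs at hr ⊢ <;> omega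
  · obtain ⟨r, hr, hr'⟩ := hd
    refine not_projective (S := fun r => ((S r).nthCosyzygy d).hull) (r := r) ?_ ?_ <;>
      simp only [Segment.hull, if_pos hr] <;> omega

/-- The short exact sequence given by the projective cover of a row module. -/
def coverShortComplex (K : Type u) [Field K] (S : ι → Segment n) :
    ShortComplex (ModuleCat.{u} (AlgA K n)ᵐᵒᵖ) :=
  ShortComplex.mk
    (ModuleCat.ofHom (trunc (K := K) (fun r => (S r).syzygy) (fun r => (S r).cover)
      (fun r => (S r).lo_le) fun _ => le_rfl))
    (ModuleCat.ofHom (trunc (K := K) (fun r => (S r).cover) S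
      (fun r => (S r).lo_le_cover) fun r => (S r).hi_le_cover))
    (by
      refine ModuleCat.hom_ext (LinearMap.ext fun x => ?_)
      exact (exact_trunc (K := K) (S := fun r => (S r).syzygy) (T := fun r => (S r).cover) (U := S)
        (fun r => (S r).lo_le) (fun _ => rfl) (fun _ => rfl) fun _ => rfl).apply_apply_eq_zero x)

theorem coverShortComplex_shortExact : (coverShortComplex K S).ShortExact where
  exact := (ShortComplex.ShortExact.moduleCat_exact_iff_function_exact _).2 <|
    exact_trunc (K := K) (S := fun r => (S r).syzygy) (T := fun r => (S r).cover) (U := S)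
      (fun r => (S r).lo_le) (fun _ => rfl) (fun _ => rfl) fun _ => rfl
  mono_f := (ModuleCat.mono_iff_injective _).2 <|
    trunc_injective (S := fun r => (S r).syzygy) (T := fun r => (S r).cover)
      (hlo := fun r => (S r).lo_le) fun _ => rfl
  epi_g := (ModuleCat.epi_iff_surjective _).2 <|
    trunc_surjective (S := fun r => (S r).cover) (T := S)
      (hhi := fun r => (S r).hi_le_cover) (fun _ _ => rfl) fun _ => le_rfl

/-- Dimension shifting along the projective covers turns a bound on the projective dimension into
the projectivity of one explicit syzygy. -/
theorem hasProjectiveDimensionLT_iff [Fintype ι] (k : ℕ) (S : ι → Segment n) :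
    HasProjectiveDimensionLT (ModuleCat.of (AlgA K n)ᵐᵒᵖ (RowModule K S)) (k + 1) ↔
      Module.Projective (AlgA K n)ᵐᵒᵖ (RowModule K fun r => Segment.syzygy^[k] (S r)) := by
  induction k generalizing S with
  | zero =>
    rw [zero_add, ← projective_iff_hasProjectiveDimensionLT_one]
    exact (IsProjective.iff_projective _).symm
  | succ k ih =>
    have hP : Module.Projective (AlgA K n)ᵐᵒᵖ (RowModule K fun r => (S r).cover) := by
      refine projective_of_hi fun r hr => ?_
      simp only [Segment.cover] at hr ⊢
      split_ifs at hr ⊢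
      · rfl
      · omega
    refine ((coverShortComplex_shortExact (K := K) (S := S)).hasProjectiveDimensionLT_X₃_iff k
      ((IsProjective.iff_projective _).1 hP)).trans ?_
    exact ih fun r => (S r).syzygy

end RowModule

/-! ### Simple modules and the reduction of the global dimension to them -/

section Simple

open NakayamaAlgebra MulOpposite

variable {K : Type u} [Field K] {n : ℕ}

/-- Left multiplication with a trivial path picks a row. -/
theorem NakayamaAlgebra.path_self_mul (a : AlgA K n) (i : Fin n) :
    path (i : ℕ) i * a = ∑ k : Fin n, a.coeff i k • path (i : ℕ) k := by
  ext x y hxy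
  rw [coeff_mul _ _ hxy, coeff_finset_sum, Matrix.sum_apply]
  simp only [coeff_smul, Matrix.smul_apply, smul_eq_mul, coeff_path]
  rw [Finset.sum_eq_single x, Finset.sum_eq_single y]
  · by_cases hx : (x : ℕ) = i
    · obtain rfl : x = i := Fin.ext hx
      have h := isPath_kupischA_iff.1 hxy
      rw [if_pos ⟨rfl, rfl, le_rfl, by omega⟩, if_pos ⟨rfl, rfl, h⟩, mul_comm]
    · rw [if_neg fun h => hx h.1, if_neg fun h => hx h.1, zero_mul, mul_zero]
  · intro b _ hb
    rw [if_neg fun h => hb (Fin.ext h.2.1.symm), mul_zero]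
  · simp
  · intro b _ hb
    rw [if_neg fun h => hb (Fin.ext (h.2.1.trans h.1.symm)), zero_mul]
  · simp

theorem NakayamaAlgebra.sum_path_self : ∑ i : Fin n, path (i : ℕ) i = (1 : AlgA K n) := by
  ext x y _
  rw [coeff_finset_sum, Matrix.sum_apply, coeff_one, Matrix.one_apply]
  simp only [coeff_path]
  rw [Finset.sum_eq_single x]
  · refine if_congr ⟨fun h => Fin.ext h.2.1.symm, ?_⟩ rfl rfl
    rintro rfl
    exact ⟨rfl, rfl, by omega⟩
  · intro b _ hb
    exact if_neg fun h => hb (Fin.ext h.1.symm)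
  · simp

/-- Every simple module is one of the interval modules supported in a single vertex. -/
theorem exists_equiv_of_isSimpleModule (N : Type u) [AddCommGroup N] [Module (AlgA K n)ᵐᵒᵖ N]
    [IsSimpleModule (AlgA K n)ᵐᵒᵖ N] : ∃ c : Fin n,
      Nonempty (RowModule K (fun _ : Unit => Segment.simple n c) ≃ₗ[(AlgA K n)ᵐᵒᵖ] N) := by
  classical
  let P : Fin n → Prop := fun i => ∃ x : N, op (path (i : ℕ) i : AlgA K n) • x ≠ 0
  have hP : ∃ i, P i := by
    by_contra! h
    have := IsSimpleModule.nontrivial (AlgA K n)ᵐᵒᵖ N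
    obtain ⟨x, hx⟩ := exists_ne (0 : N)
    apply hx
    rw [← one_smul (AlgA K n)ᵐᵒᵖ x, ← op_one, ← sum_path_self, Finset.op_sum, Finset.sum_smul]
    refine Finset.sum_eq_zero fun i _ => ?_
    by_contra hi
    exact h i ⟨x, hi⟩
  -- With `i` maximal among the vertices where `N` is nonzero, all longer paths from `i` kill `x`,
  -- so the algebra acts on `y` through the coefficient at the trivial path `i`.
  obtain ⟨i, ⟨x, hx⟩, hmax⟩ : ∃ i, P i ∧ ∀ j, i < j → ¬ P j := by
    obtain ⟨i, hi, hmax⟩ := (Set.toFinite {i | P i}).exists_maximal hP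
    exact ⟨i, hi, fun j hij hj => hij.not_ge (hmax hj hij.le)⟩
  obtain ⟨y, hy⟩ : ∃ y, y = op (path (i : ℕ) i : AlgA K n) • x := ⟨_, rfl⟩
  rw [← hy] at hx
  have hact : ∀ a : AlgA K n, op a • y = op (algebraMap K (AlgA K n) (a.coeff i i)) • y := by
    have h1 : ∀ k : Fin n, k ≠ i → op (path (i : ℕ) k : AlgA K n) • x = 0 := by
      intro k hk
      by_cases hik : (i : ℕ) ≤ k ∧ (k : ℕ) < i + 3
      · have h2 : (path (i : ℕ) k : AlgA K n) = path (i : ℕ) k * path (k : ℕ) k := by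
          rw [mul_path _ _ _ le_rfl (by omega), Finset.sum_eq_single i]
          · rw [coeff_path, if_pos ⟨rfl, rfl, hik⟩, one_smul]
          · intro b _ hb
            rw [coeff_path, if_neg fun h => hb (Fin.ext h.1), zero_smul]
          · simp
        have h3 : i < k := lt_of_le_of_ne hik.1 hk.symm
        rw [h2, op_mul, mul_smul]
        by_contra h4
        exact hmax k h3 ⟨_, h4⟩
      · rw [path_eq_zero hik, MulOpposite.op_zero, zero_smul]
    intro a
    rw [hy, ← mul_smul, ← mul_smul, ← op_mul, ← op_mul, path_self_mul, Finset.op_sum,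
      Finset.sum_smul, Finset.sum_eq_single i, ← Algebra.commutes, ← Algebra.smul_def]
    · intro k _ hk
      rw [Algebra.smul_def, Algebra.commutes, op_mul, mul_smul, h1 k hk, smul_zero]
    · simp
  have hmem : i ∈ Segment.simple n i := by
    simp only [Segment.mem_iff, Segment.simple]
    omega
  let φ : RowModule K (fun _ : Unit => Segment.simple n i) →ₗ[(AlgA K n)ᵐᵒᵖ] N :=
    { toFun := fun f => op (algebraMap K (AlgA K n) (f.coeff () i)) • y
      map_add' := fun f g => by
        rw [RowModule.coeff_add, Pi.add_apply, Pi.add_apply, map_add, MulOpposite.op_add, add_smul]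
      map_smul' := fun a f => by
        have h1 : (a • f).coeff () i = ∑ j, f.coeff () j * a.unop.coeff j i :=
          RowModule.coeff_op_smul_of_mem _ _ hmem
        rw [RingHom.id_apply, h1, Finset.sum_eq_single i,
          ← mul_smul, ← op_unop a, ← op_mul, hact (_ * _), ← Algebra.smul_def, coeff_smul,
          Matrix.smul_apply, smul_eq_mul, unop_op]
        · intro b _ hb
          rw [RowModule.coeff_eq_zero, zero_mul]
          simp only [Segment.mem_iff, Segment.simple]
          intro h
          exact hb (Fin.ext (by omega))
        · simp }
  have hφ : ∀ f, φ f = op (algebraMap K (AlgA K n) (f.coeff () i)) • y := fun _ => rfl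
  have hinj : ∀ f, φ f = 0 → f = 0 := by
    intro f hf
    ext ⟨⟩ j hj
    obtain rfl : j = i := by
      simp only [Segment.mem_iff, Segment.simple] at hj
      exact Fin.ext (by omega)
    by_contra h0
    rw [hφ] at hf
    apply hx
    rw [← one_smul (AlgA K n)ᵐᵒᵖ y, ← op_one, ← map_one (algebraMap K (AlgA K n)),
      ← mul_inv_cancel₀ h0, map_mul, op_mul, mul_smul, hf, smul_zero]
  refine ⟨i, ⟨LinearEquiv.ofBijective φ ⟨(injective_iff_map_eq_zero φ).2 hinj, ?_⟩⟩⟩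
  refine LinearMap.range_eq_top.1 ((eq_bot_or_eq_top (LinearMap.range φ)).resolve_left fun h => ?_)
  apply hx
  have h1 := LinearMap.congr_fun (LinearMap.range_eq_bot.1 h) (RowModule.mk fun _ _ => 1)
  rwa [hφ, RowModule.coeff_mk, if_pos hmem, map_one, op_one, one_smul] at h1

instance : Module.Finite K (AlgA K n) := inferInstanceAs (Module.Finite K (pathSpace K (kupischA n)))

/-- Modules of projective dimension `< d` are closed under extensions, so induction along a
composition series applies. -/
theorem hasProjectiveDimensionLT_of_isFiniteLength {d : ℕ}
    (h : ∀ c : Fin n, HasProjectiveDimensionLT (ModuleCat.of (AlgA K n)ᵐᵒᵖ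
      (RowModule K fun _ : Unit => Segment.simple n c)) d)
    {M : Type u} [AddCommGroup M] [Module (AlgA K n)ᵐᵒᵖ M]
    (hM : IsFiniteLength (AlgA K n)ᵐᵒᵖ M) :
    HasProjectiveDimensionLT (ModuleCat.of (AlgA K n)ᵐᵒᵖ M) d := by
  induction hM with
  | @of_subsingleton M _ _ _ =>
    have := (ModuleCat.isZero_of_subsingleton
      (ModuleCat.of (AlgA K n)ᵐᵒᵖ M)).hasProjectiveDimensionLT_zero
    exact hasProjectiveDimensionLT_of_ge _ 0 d (Nat.zero_le d)
  | @of_simple_quotient M _ _ N _ _ ih =>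
    obtain ⟨c, ⟨e⟩⟩ := exists_equiv_of_isSimpleModule (K := K) (n := n) (M ⧸ N)
    have := h c
    have h3 := hasProjectiveDimensionLT_of_iso e.toModuleIso d
    let T : ShortComplex (ModuleCat.{u} (AlgA K n)ᵐᵒᵖ) :=
      ShortComplex.mk (ModuleCat.ofHom N.subtype) (ModuleCat.ofHom N.mkQ) (by ext x; simp)
    have hT : T.ShortExact :=
      { exact := (ShortComplex.ShortExact.moduleCat_exact_iff_function_exact _).2
          (LinearMap.exact_subtype_mkQ N)
        mono_f := (ModuleCat.mono_iff_injective _).2 N.injective_subtype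
        epi_g := (ModuleCat.epi_iff_surjective _).2 N.mkQ_surjective }
    exact hT.hasProjectiveDimensionLT_X₂ d ih h3

/-- The first hypothesis makes the syzygies of order `k + 1` of all simple modules projective, which
bounds every finitely generated module. The other two exhibit a simple module whose `k`-th syzygy is
not projective. -/
theorem gldim_eq {k : ℕ}
    (h : ∀ c : Fin n, (Segment.syzygy^[k + 1] (Segment.simple n c)).lo <
        (Segment.syzygy^[k + 1] (Segment.simple n c)).hi →
      (Segment.syzygy^[k + 1] (Segment.simple n c)).hi =
        min ((Segment.syzygy^[k + 1] (Segment.simple n c)).lo + 3) n)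
    {c : ℕ} (hc : (Segment.syzygy^[k] (Segment.simple n c)).lo <
        (Segment.syzygy^[k] (Segment.simple n c)).hi)
    (hc' : (Segment.syzygy^[k] (Segment.simple n c)).hi <
        min ((Segment.syzygy^[k] (Segment.simple n c)).lo + 3) n) :
    gldim (AlgA K n) = ((k + 1 : ℕ) : WithBot ℕ∞) := by
  have := IsArtinianRing.of_finite K (AlgA K n)ᵐᵒᵖ
  refine le_antisymm (iSup₂_le fun M hM => ?_) ?_
  · rw [projectiveDimension_le_iff]
    refine hasProjectiveDimensionLT_of_isFiniteLength (fun c => ?_)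
      (isFiniteLength_iff_isNoetherian_isArtinian.2 ⟨inferInstance, inferInstance⟩)
    rw [RowModule.hasProjectiveDimensionLT_iff]
    exact RowModule.projective_of_hi fun _ => h c
  · refine le_iSup₂_of_le (ModuleCat.of _ (RowModule K fun _ : Unit => Segment.simple n c)) ?_ ?_
    · have : Module.Finite K (RowModule K fun _ : Unit => Segment.simple n c) :=
        inferInstanceAs (Module.Finite K (rowSpace K fun _ : Unit => Segment.simple n c))
      exact Module.Finite.of_restrictScalars_finite K _ _
    · rw [projectiveDimension_ge_iff, RowModule.hasProjectiveDimensionLT_iff]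
      exact RowModule.not_projective (r := ()) hc hc'

end Simple

/-! ### Radical powers and the modules $e_iA/e_iJ^k$ -/

namespace Segment

variable {n : ℕ}

/-- The support of the largest quotient of length at most `k` of the indecomposable projective
module at the vertex `i`. -/
def initial (i : Fin n) (k : ℕ) : Segment n where
  lo := i
  hi := min (i + min k 3) n
  lo_le := by omega
  hi_le := by omega
  hi_le_lo := by omega

end Segment

section Quotients

open NakayamaAlgebra MulOpposite

variable {K : Type u} [Field K] {n : ℕ}

namespace NakayamaAlgebra

theorem e_eq_path (i : Fin n) : (e i : AlgA K n) = path (i : ℕ) i := by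
  ext a b _
  change Matrix.single i i (1 : K) a b = _
  rw [Matrix.single_apply, coeff_path]
  refine if_congr ⟨?_, fun h => ⟨Fin.ext h.1.symm, Fin.ext h.2.1.symm⟩⟩ rfl rfl
  rintro ⟨rfl, rfl⟩
  exact ⟨rfl, rfl, le_rfl, by omega⟩

theorem coeff_e_mul (i : Fin n) (a : AlgA K n) (x y : Fin n) :
    (e i * a).coeff x y = if x = i then a.coeff x y else 0 := by
  by_cases hxy : (kupischA n).IsPath x y
  · rw [coeff_mul _ _ hxy]
    change ∑ j, Matrix.single i i (1 : K) x j * _ = _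
    simp only [Matrix.single_apply]
    rw [Finset.sum_eq_single x]
    · by_cases h : x = i
      · simp [h]
      · rw [if_neg h, if_neg fun h' => h h'.1.symm, zero_mul]
    · intro b _ hb
      rw [if_neg, zero_mul]
      rintro ⟨rfl, rfl⟩
      exact hb rfl
    · simp
  · rw [coeff_eq_zero _ hxy, coeff_eq_zero _ hxy, ite_self]

theorem path_mul_path {i j k : ℕ} (hj : j < n) (hij : i ≤ j) (hjk : j ≤ k) (hik : k < i + 3) :
    (path i j * path j k : AlgA K n) = path i k := by
  ext a b hab
  rw [coeff_mul _ _ hab, Finset.sum_eq_single ⟨j, hj⟩]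
  · simp only [coeff_path]
    by_cases ha : (a : ℕ) = i
    · by_cases hb : (b : ℕ) = k
      · rw [if_pos ⟨ha, trivial, hij, by omega⟩, if_pos ⟨trivial, hb, hjk, by omega⟩,
          if_pos ⟨ha, hb, by omega, hik⟩, one_mul]
      · rw [if_neg (c := _ ∧ (b : ℕ) = k ∧ _) fun h => hb h.2.1,
          if_neg (c := _ ∧ (b : ℕ) = k ∧ _) fun h => hb h.2.1, mul_zero]
    · rw [if_neg (c := (a : ℕ) = i ∧ _) fun h => ha h.1,
        if_neg (c := (a : ℕ) = i ∧ _) fun h => ha h.1, zero_mul]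
  · intro c _ hc
    rw [coeff_path, if_neg fun h => hc (Fin.ext h.2.1), zero_mul]
  · simp

/-- The middle factor would have to contain a path from `j` back to `i`, against the direction of
the quiver. -/
theorem path_mul_path_sandwich {i j : ℕ} (hij : i < j) (y : AlgA K n) :
    path i j * (y * path i j) = 0 := by
  ext a b hab
  rw [coeff_mul _ _ hab]
  refine Finset.sum_eq_zero fun c _ => ?_
  by_cases hc : (c : ℕ) = j
  · by_cases hcb : (kupischA n).IsPath c b
    · rw [coeff_mul _ _ hcb, Finset.sum_eq_zero, mul_zero]
      intro d _
      by_cases hd : (d : ℕ) = i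
      · rw [y.coeff_eq_zero, zero_mul]
        intro h
        have : (c : ℕ) ≤ d := h.1
        omega
      · rw [coeff_path, if_neg fun h => hd h.1, mul_zero]
    · rw [coeff_eq_zero _ hcb, mul_zero]
  · rw [coeff_path, if_neg fun h => hc h.2.1, zero_mul]

theorem path_mem_jacobson {i j : ℕ} (hij : i < j) :
    (path i j : AlgA K n) ∈ Ring.jacobson (AlgA K n) := by
  rw [← Ideal.jacobson_bot, Ideal.mem_jacobson_iff]
  intro y
  have h : y * path i j * (y * path i j) = 0 := by
    rw [mul_assoc, path_mul_path_sandwich hij, mul_zero]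
  -- As `y * path i j` squares to zero, `1 - y * path i j` is a left inverse of `1 + y * path i j`.
  refine ⟨1 - y * path i j, (Submodule.mem_bot _).2 ?_⟩
  rw [mul_assoc, sub_mul, one_mul, h]
  abel

theorem path_mem_jacobson_pow {i j k : ℕ} (h : i + k ≤ j) (hj : j < n) :
    (path i j : AlgA K n) ∈ Ring.jacobson (AlgA K n) ^ k := by
  induction k generalizing j with
  | zero =>
    rw [Submodule.pow_zero, Ideal.one_eq_top]
    trivial
  | succ k ih =>
    by_cases hij : j < i + 3
    · rw [← path_mul_path (j := j - 1) (by omega) (by omega) (by omega) hij, Submodule.pow_succ]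
      exact Ideal.mul_mem_mul (ih (by omega) (by omega)) (path_mem_jacobson (by omega))
    · rw [path_eq_zero (by omega)]
      exact zero_mem _

/-- The left ideal of the combinations of the paths of length at least `k`. -/
def pathIdeal (K : Type u) [Field K] (n k : ℕ) : Ideal (AlgA K n) where
  carrier := {x | ∀ i j : Fin n, (j : ℕ) < i + k → x.coeff i j = 0}
  add_mem' {x y} hx hy i j h := by
    rw [coeff_add, Matrix.add_apply, hx i j h, hy i j h, add_zero]
  zero_mem' _ _ _ := rfl
  smul_mem' a x hx i j h := by
    by_cases hij : (kupischA n).IsPath i j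
    · rw [smul_eq_mul, coeff_mul _ _ hij]
      refine Finset.sum_eq_zero fun l _ => ?_
      by_cases hil : i ≤ l
      · have : (i : ℕ) ≤ l := hil
        rw [hx l j (by omega), mul_zero]
      · rw [a.coeff_eq_zero fun h => hil h.1, zero_mul]
    · exact coeff_eq_zero _ hij

theorem mem_pathIdeal {k : ℕ} {x : AlgA K n} :
    x ∈ pathIdeal K n k ↔ ∀ i j : Fin n, (j : ℕ) < i + k → x.coeff i j = 0 := Iff.rfl

/-- The coefficient at a trivial path is multiplicative. -/
def diag (K : Type u) [Field K] {n : ℕ} (i : Fin n) : AlgA K n →+* K where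
  toFun x := x.coeff i i
  map_one' := by rw [coeff_one, Matrix.one_apply_eq]
  map_mul' x y := by
    rw [coeff_mul _ _ ((kupischA n).isPath_self i), Finset.sum_eq_single i]
    · intro j _ hj
      by_cases hij : i ≤ j
      · rw [y.coeff_eq_zero fun h => hj (le_antisymm h.1 hij), mul_zero]
      · rw [x.coeff_eq_zero fun h => hij h.1, zero_mul]
    · simp
  map_zero' := rfl
  map_add' _ _ := rfl

theorem diag_surjective (i : Fin n) : Function.Surjective (diag K i) := fun a =>
  ⟨algebraMap K _ a, by
    change coeff (algebraMap K (AlgA K n) a) i i = a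
    rw [Algebra.algebraMap_eq_smul_one, coeff_smul, coeff_one]
    simp⟩

/-- `diag` maps onto a field, so its kernel is a maximal ideal and contains the radical. -/
theorem coeff_self_eq_zero_of_mem_jacobson {x : AlgA K n} (hx : x ∈ Ring.jacobson (AlgA K n))
    (i : Fin n) : x.coeff i i = 0 := by
  have := RingHom.ker_isMaximal_of_surjective _ (diag_surjective (K := K) i)
  exact Ring.jacobson_le_of_isMaximal (RingHom.ker (diag K i)) hx

/-- Together with `path_mem_jacobson_pow` this shows that $J^k$ is spanned by the paths of length at
least `k`. -/
theorem jacobson_pow_le_pathIdeal (k : ℕ) :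
    Ring.jacobson (AlgA K n) ^ k ≤ pathIdeal K n k := by
  induction k with
  | zero =>
    intro x _ i j h
    refine x.coeff_eq_zero fun h' => ?_
    have : (i : ℕ) ≤ j := h'.1
    omega
  | succ k ih =>
    rw [Submodule.pow_succ, Ideal.mul_le]
    intro x hx y hy i j h
    by_cases hij : (kupischA n).IsPath i j
    · rw [coeff_mul _ _ hij]
      refine Finset.sum_eq_zero fun l _ => ?_
      by_cases hlj : (kupischA n).IsPath l j
      · by_cases hl : l = j
        · rw [hl, coeff_self_eq_zero_of_mem_jacobson hy, mul_zero]
        · have h1 : (l : ℕ) ≤ j := hlj.1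
          have h2 : (l : ℕ) ≠ j := fun h => hl (Fin.ext h)
          rw [mem_pathIdeal.1 (ih hx) i l (by omega), zero_mul]
      · rw [y.coeff_eq_zero hlj, mul_zero]
    · exact coeff_eq_zero _ hij

end NakayamaAlgebra

namespace RowModule

/-- The regular module is the direct sum of the indecomposable projective modules. -/
def regularEquiv (K : Type u) [Field K] (n : ℕ) :
    AlgA K n ≃ₗ[(AlgA K n)ᵐᵒᵖ] RowModule K fun i : Fin n => Segment.initial i 3 where
  toFun a := mk fun i j => a.coeff i j
  map_add' a b := by ext r j h; simp [coeff_mk, h]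
  map_smul' x a := by
    ext r j h
    rw [coeff_mk, if_pos h, RingHom.id_apply,
      coeff_op_smul_of_mem (S := fun i : Fin n => Segment.initial i 3) _ _ h, smul_eq_mul_unop,
      coeff_mul _ _ (isPath_kupischA_iff.2 (by
        simp only [Segment.mem_iff, Segment.initial] at h; omega))]
    refine Finset.sum_congr rfl fun l _ => ?_
    rw [coeff_mk]
    split_ifs with hl
    · rfl
    · rw [a.coeff_eq_zero, zero_mul]
      intro h'
      have := isPath_kupischA_iff.1 h'
      simp only [Segment.mem_iff, Segment.initial] at hl
      omega
  invFun f := ⟨Matrix.of f.coeff, fun i j h => f.coeff_eq_zero fun h' => h <| by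
    simp only [Segment.mem_iff, Segment.initial] at h'
    exact isPath_kupischA_iff.2 (by omega)⟩
  left_inv a := by
    ext i j h
    have h' := isPath_kupischA_iff.1 h
    change (mk fun i j => a.coeff i j : RowModule K fun i : Fin n => Segment.initial i 3).coeff i j = _
    rw [coeff_mk, if_pos]
    simp only [Segment.mem_iff, Segment.initial]
    omega
  right_inv f := by
    ext i j h
    exact if_pos h

/-- The projection to the row `r`. -/
def row {ι : Type} (S : ι → Segment n) (r : ι) :
    RowModule K S →ₗ[(AlgA K n)ᵐᵒᵖ] RowModule K fun _ : Unit => S r where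
  toFun f := mk fun _ => f.coeff r
  map_add' f g := by ext _ j h; simp [coeff_mk, h]
  map_smul' x f := by
    ext ⟨⟩ j h
    rw [RingHom.id_apply, coeff_mk, if_pos h, coeff_op_smul_of_mem _ _ h]
    refine Eq.trans ?_ (coeff_op_smul_of_mem (S := fun _ : Unit => S r) _ _ h).symm
    refine Finset.sum_congr rfl fun l _ => ?_
    rw [coeff_mk]
    split_ifs with hl
    · rfl
    · rw [f.coeff_eq_zero hl]

theorem coeff_row {ι : Type} {S : ι → Segment n} (r : ι) (f : RowModule K S) (j : Fin n) :
    (row S r f).coeff () j = f.coeff r j := by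
  change (if j ∈ S r then f.coeff r j else 0) = _
  split_ifs with h
  · rfl
  · rw [f.coeff_eq_zero h]

/-- A row module with at most two nonempty rows is the direct sum of these two rows. -/
def equivProd {ι : Type} [DecidableEq ι] {S : ι → Segment n} {r₁ r₂ : ι} (hr : r₁ ≠ r₂)
    (h : ∀ r, r ≠ r₁ → r ≠ r₂ → (S r).lo = (S r).hi) :
    RowModule K S ≃ₗ[(AlgA K n)ᵐᵒᵖ]
      RowModule K (fun _ : Unit => S r₁) × RowModule K (fun _ : Unit => S r₂) :=
  { (row S r₁).prod (row S r₂) with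
    invFun := fun p => mk fun r j =>
      if r = r₁ then p.1.coeff () j else if r = r₂ then p.2.coeff () j else 0
    left_inv := fun f => by
      ext r j hj
      rw [coeff_mk, if_pos hj]
      split_ifs with h1 h2
      · subst h1
        exact coeff_row _ _ _
      · subst h2
        exact coeff_row _ _ _
      · have := h r h1 h2
        have := hj.1
        have := hj.2
        omega
    right_inv := fun p => by
      refine Prod.ext ?_ ?_
      · ext ⟨⟩ j hj
        refine (coeff_row _ _ _).trans ?_
        rw [coeff_mk, if_pos hj, if_pos rfl]
      · ext ⟨⟩ j hj
        refine (coeff_row _ _ _).trans ?_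
        rw [coeff_mk, if_pos hj, if_neg hr.symm, if_pos rfl] }

/-- The quotient `e_i A → e_i A / e_i J ^ k` as a map to an interval module. -/
def initialMap (K : Type u) [Field K] (i : Fin n) (k : ℕ) :
    AlgA K n →ₗ[(AlgA K n)ᵐᵒᵖ] RowModule K fun _ : Unit => Segment.initial i k :=
  trunc (fun _ => Segment.initial i 3) _ (fun _ => le_rfl)
    (fun _ => by simp only [Segment.initial]; omega) ∘ₗ
    row (fun i : Fin n => Segment.initial i 3) i ∘ₗ (regularEquiv K n).toLinearMap

theorem coeff_initialMap (i : Fin n) (k : ℕ) (a : AlgA K n) {j : Fin n}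
    (hj : j ∈ Segment.initial i k) : (initialMap K i k a).coeff () j = a.coeff i j := by
  refine (if_pos hj).trans ((coeff_row i (regularEquiv K n a) j).trans (if_pos ?_))
  simp only [Segment.mem_iff, Segment.initial] at hj ⊢
  omega

theorem initialMap_eq_zero_iff (i : Fin n) (k : ℕ) (a : AlgA K n) :
    initialMap K i k a = 0 ↔ ∀ j : Fin n, (j : ℕ) < i + k → a.coeff i j = 0 := by
  constructor
  · intro h j hj
    by_cases hij : (kupischA n).IsPath i j
    · have := isPath_kupischA_iff.1 hij
      rw [← coeff_initialMap i k a, h]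
      · rfl
      · simp only [Segment.mem_iff, Segment.initial]
        omega
    · exact a.coeff_eq_zero hij
  · intro h
    ext ⟨⟩ j hj
    rw [coeff_initialMap _ _ _ hj, h]
    · rfl
    · simp only [Segment.mem_iff, Segment.initial] at hj
      omega

theorem e_mul_of_mem_rightIdeal {i : Fin n} {a : AlgA K n} (ha : a ∈ rightIdeal (e i : AlgA K n)) :
    e i * a = a := by
  obtain ⟨b, rfl⟩ := Submodule.mem_span_singleton.1 ha
  ext x y _
  rw [smul_eq_mul_unop, coeff_e_mul, coeff_e_mul]
  split_ifs <;> rfl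

theorem mem_rightIdealRadPow_iff {i : Fin n} {k : ℕ} {a : AlgA K n}
    (ha : a ∈ rightIdeal (e i : AlgA K n)) :
    a ∈ rightIdealRadPow (e i) k ↔ initialMap K i k a = 0 := by
  constructor
  · intro h
    have hle : rightIdealRadPow (e i : AlgA K n) k ≤ LinearMap.ker (initialMap K i k) := by
      refine Submodule.span_le.2 ?_
      rintro _ ⟨x, hx, rfl⟩
      refine LinearMap.mem_ker.2 ((initialMap_eq_zero_iff _ _ _).2 fun j hj => ?_)
      rw [coeff_e_mul, if_pos rfl]
      exact jacobson_pow_le_pathIdeal k hx i j hj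
    exact hle h
  · intro h
    rw [initialMap_eq_zero_iff] at h
    have h1 : a ∈ Ring.jacobson (AlgA K n) ^ k := by
      rw [← e_mul_of_mem_rightIdeal ha, e_eq_path, path_self_mul]
      refine Ideal.sum_mem _ fun j _ => ?_
      by_cases hj : (j : ℕ) < i + k
      · rw [h j hj, zero_smul]
        exact zero_mem _
      · rw [Algebra.smul_def]
        exact Ideal.mul_mem_left _ _ (path_mem_jacobson_pow (by omega) j.2)
    rw [← e_mul_of_mem_rightIdeal ha]
    exact Submodule.subset_span ⟨a, h1, rfl⟩

/-- The module `e_i A / e_i J ^ k` is an interval module. -/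
def radQuotientEquiv (K : Type u) [Field K] (i : Fin n) (k : ℕ) :
    RadQuotient (e i : AlgA K n) k ≃ₗ[(AlgA K n)ᵐᵒᵖ]
      RowModule K fun _ : Unit => Segment.initial i k :=
  Submodule.quotEquivOfEq _ (LinearMap.ker (initialMap K i k ∘ₗ (rightIdeal (e i)).subtype)) (by
    ext ⟨a, ha⟩
    exact mem_rightIdealRadPow_iff ha) ≪≫ₗ
  LinearMap.quotKerEquivOfSurjective _ (by
    intro f
    let a : AlgA K n := ⟨Matrix.of fun x y => if x = i then f.coeff () y else 0, fun x y h => by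
      rw [Matrix.of_apply]
      split_ifs with hx
      · refine f.coeff_eq_zero fun h' => h (isPath_kupischA_iff.2 ?_)
        simp only [Segment.mem_iff, Segment.initial] at h'
        rw [hx]
        omega
      · rfl⟩
    have ha : a.coeff = Matrix.of fun x y => if x = i then f.coeff () y else 0 := rfl
    refine ⟨⟨a, Submodule.mem_span_singleton.2 ⟨op a, ?_⟩⟩, ?_⟩
    · ext x y _
      rw [op_smul_eq_mul, coeff_e_mul, ha, Matrix.of_apply, ite_eq_left_iff]
      exact fun h => (if_neg h).symm
    · ext ⟨⟩ j hj
      refine (coeff_initialMap i k a hj).trans ?_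
      rw [ha, Matrix.of_apply, if_pos rfl])

end RowModule

end Quotients

/-! ### The walks of segments under cosyzygies and syzygies -/

namespace Segment

variable {n : ℕ}

theorem cosyzygy_lo (s : Segment n) :
    s.cosyzygy.lo = if s.lo < s.hi then s.hi - 3 else s.lo := rfl

theorem cosyzygy_hi (s : Segment n) : s.cosyzygy.hi = s.lo := rfl

theorem syzygy_lo (s : Segment n) : s.syzygy.lo = s.hi := rfl

theorem syzygy_hi (s : Segment n) :
    s.syzygy.hi = if s.lo < s.hi then min (s.lo + 3) n else s.hi := rfl

/-- Two steps of the minimal injective resolution of a simple module move it by three vertices. -/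
theorem nthCosyzygy_add_two_mul {s : Segment n} {k c : ℕ} (hlo : (s.nthCosyzygy k).lo = c - 1)
    (hhi : (s.nthCosyzygy k).hi = c) (j : ℕ) :
    (s.nthCosyzygy (k + 2 * j)).lo = c - 3 * j - 1 ∧ (s.nthCosyzygy (k + 2 * j)).hi = c - 3 * j := by
  induction j with
  | zero => exact ⟨hlo, hhi⟩
  | succ j ih =>
    change (s.nthCosyzygy (k + 2 * j)).cosyzygy.cosyzygy.lo = _ ∧
      (s.nthCosyzygy (k + 2 * j)).cosyzygy.cosyzygy.hi = _
    simp only [cosyzygy_lo, cosyzygy_hi, ih.1, ih.2]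
    -- Truncation is harmless at the left end: once `c - 3 * j ≤ 1`, the next odd term is the empty
    -- segment at `0`, and both formulas then remain at `0`.
    constructor <;> split_ifs <;> omega

theorem nthCosyzygy_add_two_mul_add_one {s : Segment n} {k c : ℕ}
    (hlo : (s.nthCosyzygy k).lo = c - 1) (hhi : (s.nthCosyzygy k).hi = c) (j : ℕ) :
    (s.nthCosyzygy (k + 2 * j + 1)).lo = c - 3 * j - 3 ∧
      (s.nthCosyzygy (k + 2 * j + 1)).hi = c - 3 * j - 1 := by
  obtain ⟨h1, h2⟩ := nthCosyzygy_add_two_mul hlo hhi j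
  change (s.nthCosyzygy (k + 2 * j)).cosyzygy.lo = _ ∧ (s.nthCosyzygy (k + 2 * j)).cosyzygy.hi = _
  simp only [cosyzygy_lo, cosyzygy_hi, h1, h2, and_true]
  split_ifs <;> omega

/-- The projective modules of length three are injective. -/
theorem nthCosyzygy_initial_of_le {i : Fin n} (hi : (i : ℕ) + 3 ≤ n) {k : ℕ} (hk : k ≠ 0) :
    ((initial i 3).nthCosyzygy k).lo = ((initial i 3).nthCosyzygy k).hi := by
  obtain ⟨k, rfl⟩ := Nat.exists_eq_succ_of_ne_zero hk
  induction k with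
  | zero =>
    change (initial i 3).cosyzygy.lo = (initial i 3).cosyzygy.hi
    rw [cosyzygy_lo, if_pos] <;> simp only [initial, cosyzygy_hi] <;> omega
  | succ k ih =>
    have := ih k.succ_ne_zero
    change ((initial i 3).nthCosyzygy (k + 1)).cosyzygy.lo =
      ((initial i 3).nthCosyzygy (k + 1)).cosyzygy.hi
    rw [cosyzygy_lo, cosyzygy_hi, if_neg]
    exact this.not_lt

/-- The even cosyzygies of the projective module at the last vertex. -/
theorem nthCosyzygy_last_even {i : Fin n} (hi : (i : ℕ) + 1 = n) (j : ℕ) :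
    ((initial i 3).nthCosyzygy (2 * j)).lo = n - 3 * j - 1 ∧
      ((initial i 3).nthCosyzygy (2 * j)).hi = n - 3 * j := by
  have := nthCosyzygy_add_two_mul (s := initial i 3) (k := 0) (c := n)
    (by simp only [nthCosyzygy, initial]; omega) (by simp only [nthCosyzygy, initial]; omega) j
  rwa [zero_add] at this

/-- The odd cosyzygies of the projective module at the last vertex. -/
theorem nthCosyzygy_last_odd {i : Fin n} (hi : (i : ℕ) + 1 = n) (j : ℕ) :
    ((initial i 3).nthCosyzygy (2 * j + 1)).lo = n - 3 * j - 3 ∧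
      ((initial i 3).nthCosyzygy (2 * j + 1)).hi = n - 3 * j - 1 := by
  have := nthCosyzygy_add_two_mul_add_one (s := initial i 3) (k := 0) (c := n)
    (by simp only [nthCosyzygy, initial]; omega) (by simp only [nthCosyzygy, initial]; omega) j
  rwa [zero_add] at this

/-- The hull of $[n-2,n)$ adds one vertex on the left, so from degree `1` on the rule for simple
modules applies with `c = n - 2`. -/
theorem cosyzygy_initial_penultimate {i : Fin n} (hi : (i : ℕ) + 2 = n) :
    ((initial i 3).nthCosyzygy 1).lo = n - 2 - 1 ∧ ((initial i 3).nthCosyzygy 1).hi = n - 2 := by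
  change (initial i 3).cosyzygy.lo = _ ∧ (initial i 3).cosyzygy.hi = _
  rw [cosyzygy_lo, if_pos] <;> simp only [initial, cosyzygy_hi] <;> omega

/-- The odd cosyzygies of the projective module at the penultimate vertex. -/
theorem nthCosyzygy_penultimate_odd {i : Fin n} (hi : (i : ℕ) + 2 = n) (j : ℕ) :
    ((initial i 3).nthCosyzygy (2 * j + 1)).lo = n - 2 - 3 * j - 1 ∧
      ((initial i 3).nthCosyzygy (2 * j + 1)).hi = n - 2 - 3 * j := by
  obtain ⟨h1, h2⟩ := cosyzygy_initial_penultimate hi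
  have := nthCosyzygy_add_two_mul h1 h2 j
  rwa [add_comm] at this

/-- The positive even cosyzygies of the projective module at the penultimate vertex. -/
theorem nthCosyzygy_penultimate_even {i : Fin n} (hi : (i : ℕ) + 2 = n) (j : ℕ) :
    ((initial i 3).nthCosyzygy (2 * j + 2)).lo = n - 2 - 3 * j - 3 ∧
      ((initial i 3).nthCosyzygy (2 * j + 2)).hi = n - 2 - 3 * j - 1 := by
  obtain ⟨h1, h2⟩ := cosyzygy_initial_penultimate hi
  have := nthCosyzygy_add_two_mul_add_one h1 h2 j
  rwa [add_comm 1, add_assoc] at this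

/-- Two steps of the minimal projective resolution of a simple module move it by three vertices. -/
theorem syzygy_iterate_simple (c k : ℕ) :
    Segment.syzygy^[2 * k] (simple n c) = simple n (c + 3 * k) := by
  induction k generalizing c with
  | zero => rfl
  | succ k ih =>
    -- The caps at `n` make this valid beyond the right end too, where both sides are empty.
    have h : (simple n c).syzygy.syzygy = simple n (c + 3) := by
      ext <;> simp only [syzygy_lo, syzygy_hi, simple] <;> split_ifs <;> omega
    rw [show 2 * (k + 1) = 2 * k + 1 + 1 by ring, Function.iterate_succ_apply,
      Function.iterate_succ_apply, h, ih]
    congr 1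
    ring

theorem syzygy_iterate_simple_add_one (c k : ℕ) :
    Segment.syzygy^[2 * k + 1] (simple n c) = (simple n (c + 3 * k)).syzygy := by
  rw [Function.iterate_succ_apply', syzygy_iterate_simple]

/-- The first `d` nonzero cosyzygies of each indecomposable projective module end at the vertex `2`
or later, for `d` in the stated range. -/
theorem three_le_nthCosyzygy_hi {d i : ℕ} (hi : i < d) (r : Fin n)
    (hr : ((initial r 3).nthCosyzygy i).lo < ((initial r 3).nthCosyzygy i).hi)
    (hd : 3 * d ≤ 2 * n - 3) : 3 ≤ ((initial r 3).nthCosyzygy i).hi := by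
  rcases Nat.lt_or_ge n (r + 3) with h | h
  · obtain h | h : (r : ℕ) + 1 = n ∨ (r : ℕ) + 2 = n := by have := r.2; omega
    · obtain ⟨j, rfl | rfl⟩ := i.even_or_odd'
      · have := nthCosyzygy_last_even h j
        omega
      · have := nthCosyzygy_last_odd h j
        omega
    · obtain ⟨j, rfl | rfl⟩ := i.even_or_odd'
      · cases j with
        | zero =>
          simp only [nthCosyzygy, initial]
          omega
        | succ j =>
          have := nthCosyzygy_penultimate_even h j
          rw [mul_add, mul_one] at hi ⊢
          omega
      · have := nthCosyzygy_penultimate_odd h j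
        omega
  · cases i with
    | zero =>
      simp only [nthCosyzygy, initial]
      omega
    | succ i => exact absurd (nthCosyzygy_initial_of_le h i.succ_ne_zero) hr.ne

end Segment

/-! ### The invariants of $A_n$ -/

open NakayamaAlgebra

/-- Two degrees cost three vertices, so `3 * d ≤ 2 * n - 3` keeps both walks at right ends `≥ 3`,
with projective hulls, in all degrees below `d`. The second hypothesis is the failure in degree `d`.
-/
theorem domdim_algA_eq (K : Type u) [Field K] {n d : ℕ} (hd : 3 * d ≤ 2 * n - 3)
    (hr : ∃ r : Fin n, ((Segment.initial r 3).nthCosyzygy d).lo <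
        ((Segment.initial r 3).nthCosyzygy d).hi ∧
      ((Segment.initial r 3).nthCosyzygy d).hi < min 3 n) : domdim (AlgA K n) = d :=
  RowModule.moduleDomdim_eq (M := regularModule (AlgA K n)) (RowModule.regularEquiv K n) d
    (fun _ hi r hr => Segment.three_le_nthCosyzygy_hi hi r hr hd) hr

/-- All rows other than `r₁` and `r₂` are injective, so they vanish in every positive degree `d` and
two summands remain. -/
theorem cosyzygyIso_algA (K : Type u) [Field K] {n d k l : ℕ} (hd : d ≠ 0) {r₁ r₂ i j : Fin n}
    (hne : r₁ ≠ r₂) (hr : ∀ r : Fin n, r ≠ r₁ → r ≠ r₂ → (r : ℕ) + 3 ≤ n)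
    (h₁ : (Segment.initial r₁ 3).nthCosyzygy d = Segment.initial i k)
    (h₂ : (Segment.initial r₂ 3).nthCosyzygy d = Segment.initial j l) :
    CosyzygyIso (regularModule (AlgA K n)) d
      (RadQuotient (e i : AlgA K n) k × RadQuotient (e j : AlgA K n) l) := by
  have f := RowModule.equivProd (K := K) (S := fun r => (Segment.initial r 3).nthCosyzygy d) hne
    fun r h1 h2 => Segment.nthCosyzygy_initial_of_le (hr r h1 h2) hd
  rw [h₁, h₂] at f
  exact (RowModule.hullSequence K fun r : Fin n => Segment.initial r 3).cosyzygyIso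
    (M := regularModule (AlgA K n)) (RowModule.regularEquiv K n) d (f ≪≫ₗ LinearEquiv.prodCongr
      (RowModule.radQuotientEquiv K i k).symm (RowModule.radQuotientEquiv K j l).symm)

/-- The syzygy of order $2m$ of $S_c$ is $S_{c+3m}$, which is the projective $S_{n-1}$ for $c=0$ and
zero otherwise. One step earlier, $S_0$ yields $[3m-2,3m)$, which stops short of the last vertex. -/
theorem gldim_algA_even (K : Type u) [Field K] {m : ℕ} (hm : 1 ≤ m) :
    gldim (AlgA K (3 * m + 1)) = ((2 * m : ℕ) : WithBot ℕ∞) := by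
  obtain ⟨m, rfl⟩ := Nat.exists_eq_add_of_le' hm
  refine gldim_eq (K := K) (k := 2 * m + 1) (c := 0) (fun c => ?_) ?_ ?_
  · rw [show 2 * m + 1 + 1 = 2 * (m + 1) by ring, Segment.syzygy_iterate_simple]
    simp only [Segment.simple]
    omega
  all_goals
    rw [Segment.syzygy_iterate_simple_add_one]
    simp only [Segment.syzygy_lo, Segment.syzygy_hi, Segment.simple]
    split_ifs <;> omega

/-- Here $\Omega^{2m}S_0=S_{3m}$ with $3m<n-1$ is not projective, but one further syzygy of any
simple module is empty or reaches the right end. -/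
theorem gldim_algA_odd (K : Type u) [Field K] {n m : ℕ} (h : 3 * m + 2 ≤ n) (h' : n ≤ 3 * m + 3) :
    gldim (AlgA K n) = ((2 * m + 1 : ℕ) : WithBot ℕ∞) := by
  refine gldim_eq (K := K) (k := 2 * m) (c := 0) (fun c => ?_) ?_ ?_
  · rw [Segment.syzygy_iterate_simple_add_one]
    simp only [Segment.syzygy_lo, Segment.syzygy_hi, Segment.simple]
    split_ifs <;> omega
  all_goals
    rw [Segment.syzygy_iterate_simple]
    simp only [Segment.simple]
    omega
end

theorem mainTheorem2 (K : Type u) [Field K] (m : ℕ) (hm : 1 ≤ m) :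
    (domdim (AlgA K (3 * m)) = ((2 * m - 1 : ℕ) : ℕ∞) ∧
      gldim (AlgA K (3 * m)) = ((2 * m - 1 : ℕ) : WithBot ℕ∞)) ∧
    (domdim (AlgA K (3 * m + 1)) = ((2 * m - 1 : ℕ) : ℕ∞) ∧
      gldim (AlgA K (3 * m + 1)) = ((2 * m : ℕ) : WithBot ℕ∞) ∧
      CosyzygyIso (regularModule (AlgA K (3 * m + 1))) (2 * m - 1)
        (RadQuotient (NakayamaAlgebra.e ⟨1, by omega⟩ : AlgA K (3 * m + 1)) 2 ×
          RadQuotient (NakayamaAlgebra.e ⟨1, by omega⟩ : AlgA K (3 * m + 1)) 1)) ∧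
    (domdim (AlgA K (3 * m + 2)) = ((2 * m : ℕ) : ℕ∞) ∧
      gldim (AlgA K (3 * m + 2)) = ((2 * m + 1 : ℕ) : WithBot ℕ∞) ∧
      CosyzygyIso (regularModule (AlgA K (3 * m + 2))) (2 * m)
        (RadQuotient (NakayamaAlgebra.e ⟨0, by omega⟩ : AlgA K (3 * m + 2)) 2 ×
          RadQuotient (NakayamaAlgebra.e ⟨1, by omega⟩ : AlgA K (3 * m + 2)) 1)) := by
  -- These bring the degrees into the shapes `2 * j + 2` and `2 * j + 1` of the walk formulas, with
  -- `j = m - 1`.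
  have h2 : 2 * m = 2 * (m - 1) + 2 := by omega
  have h1 : 2 * m - 1 = 2 * (m - 1) + 1 := by omega
  -- The rows with a nonprojective hull are the last one for $A_{3m}$, with term $[0,2)$, the
  -- penultimate one for $A_{3m+1}$, with term $[1,2)$, and the last one for $A_{3m+2}$, again with
  -- $[1,2)$.
  refine ⟨⟨domdim_algA_eq K (by omega) ⟨⟨3 * m - 1, by omega⟩, ?_⟩, ?_⟩,
    ⟨domdim_algA_eq K (by omega) ⟨⟨3 * m - 1, by omega⟩, ?_⟩, gldim_algA_even K hm,
      cosyzygyIso_algA K (r₁ := ⟨3 * m, by omega⟩) (r₂ := ⟨3 * m - 1, by omega⟩) (by omega)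
        (by simp only [ne_eq, Fin.mk.injEq]; omega) (fun r hr hr' => ?_) ?_ ?_⟩,
    ⟨domdim_algA_eq K (by omega) ⟨⟨3 * m + 1, by omega⟩, ?_⟩,
      gldim_algA_odd K le_rfl (Nat.le_succ _),
      cosyzygyIso_algA K (r₁ := ⟨3 * m, by omega⟩) (r₂ := ⟨3 * m + 1, by omega⟩) (by omega)
        (by simp only [ne_eq, Fin.mk.injEq]; omega) (fun r hr hr' => ?_) ?_ ?_⟩⟩
  · have := Segment.nthCosyzygy_last_odd (i := ⟨3 * m - 1, by omega⟩)
      (by omega : 3 * m - 1 + 1 = 3 * m) (m - 1)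
    rw [h1]
    omega
  · rw [h1]
    exact gldim_algA_odd K (by omega) (by omega)
  · have := Segment.nthCosyzygy_penultimate_odd (i := ⟨3 * m - 1, by omega⟩)
      (by omega : 3 * m - 1 + 2 = 3 * m + 1) (m - 1)
    rw [h1]
    omega
  · have := r.2
    simp only [ne_eq, Fin.ext_iff] at hr hr'
    omega
  · have := Segment.nthCosyzygy_last_odd (i := ⟨3 * m, by omega⟩) (rfl : 3 * m + 1 = 3 * m + 1) (m - 1)
    rw [h1]
    ext
    · exact this.1.trans (by simp only [Segment.initial]; omega)
    · exact this.2.trans (by simp only [Segment.initial]; omega)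
  · have := Segment.nthCosyzygy_penultimate_odd (i := ⟨3 * m - 1, by omega⟩)
      (by omega : 3 * m - 1 + 2 = 3 * m + 1) (m - 1)
    rw [h1]
    ext
    · exact this.1.trans (by simp only [Segment.initial]; omega)
    · exact this.2.trans (by simp only [Segment.initial]; omega)
  · have := Segment.nthCosyzygy_last_even (i := ⟨3 * m + 1, by omega⟩)
      (rfl : 3 * m + 1 + 1 = 3 * m + 2) m
    omega
  · have := r.2
    simp only [ne_eq, Fin.ext_iff] at hr hr'
    omega
  · have := Segment.nthCosyzygy_penultimate_even (i := ⟨3 * m, by omega⟩)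
      (rfl : 3 * m + 2 = 3 * m + 2) (m - 1)
    rw [h2]
    ext
    · exact this.1.trans (by simp only [Segment.initial]; omega)
    · exact this.2.trans (by simp only [Segment.initial]; omega)
  · have := Segment.nthCosyzygy_last_even (i := ⟨3 * m + 1, by omega⟩)
      (rfl : 3 * m + 1 + 1 = 3 * m + 2) m
    ext
    · exact this.1.trans (by simp only [Segment.initial]; omega)
    · exact this.2.trans (by simp only [Segment.initial]; omega)
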